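/- Let $F/\mathbf{Q}$ be an imaginary quadratic field with ring of integers $\mathcal{O}$, discriminant $d_F$ and a fixed embedding $F\hookrightarrow\mathbf{C}$, which identifies the completion of $F$ at its infinite place with $\mathbf{C}$, and let $x\mapsto\overline{x}$ denote complex conjugation on $F$ and on the adele ring $\mathbf{A}_F$. A Hecke character of $F$ is a continuous homomorphism $\lambda: F^*\backslash\mathbf{A}_F^*\to\mathbf{C}^*$; it has infinity type $z^m\overline{z}^n$ if its restriction to $\mathbf{C}^*$ (the infinite component) is $z\mapsto z^m\overline{z}^n$. Put $\lambda^c(x)=\lambda(\overline{x})$, and let $\overline{\lambda}$ be the character $x\mapsto\overline{\lambda(x)}$. Let $p$ be a prime number that does not ramify in $F$. Let $\phi_1$ and $\phi_2$ be Hecke characters of $F$ of infinity type $z$ and $z^{-1}$, respectively, and let $\Sigma_\phi$ be the finite set of places of $F$ dividing the conductors of $\phi_1$ and $\phi_2$, the complex conjugates of these conductors, or $p\,d_F$. If $\chi=\phi_1/\phi_2$ satisfies $\chi^c=\overline{\chi}$, then there exists a Hecke character $\eta$ of $F$ of finite order, unramified outside $\Sigma_\phi$ (that is, trivial on $\mathcal{O}_v^*$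 for every finite place $v\notin\Sigma_\phi$), such that $$(\phi_1\phi_2\eta^2)^c=\phi_1\phi_2\eta^2 .$$ -/

import Mathlib

open NumberField IsDedekindDomain

set_option linter.unusedSectionVars false

noncomputable section

namespace HeckeTwist

/-! ### Automorphisms of a number field acting on its adeles -/

section AdeleAction

variable {F : Type*} [Field F] [NumberField F]

/-- The place `σ⁻¹ v` below an automorphism: its prime ideal is `{x | σ x ∈ v}`. -/
def pullPlace (σ : F ≃+* F) (v : HeightOneSpectrum (𝓞 F)) : HeightOneSpectrum (𝓞 F) :=
  v.comap (RingOfIntegers.mapRingEquiv σ : 𝓞 F →+* 𝓞 F) (RingOfIntegers.mapRingEquiv σ).surjective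

theorem mem_pullPlace_pow (σ : F ≃+* F) (v : HeightOneSpectrum (𝓞 F)) (n : ℕ) (r : 𝓞 F) :
    r ∈ (pullPlace σ v).asIdeal ^ n ↔ RingOfIntegers.mapRingEquiv σ r ∈ v.asIdeal ^ n := by
  have h : (pullPlace σ v).asIdeal = v.asIdeal.map (RingOfIntegers.mapRingEquiv σ).symm := by
    rw [Ideal.map_symm]; rfl
  rw [h, ← Ideal.map_pow, Ideal.map_symm, Ideal.mem_comap]

theorem intValuation_pullPlace (σ : F ≃+* F) (v : HeightOneSpectrum (𝓞 F)) (r : 𝓞 F) :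
    (pullPlace σ v).intValuation r = v.intValuation (RingOfIntegers.mapRingEquiv σ r) := by
  by_cases hr : r = 0
  · simp [hr]
  · have hr' : RingOfIntegers.mapRingEquiv σ r ≠ 0 := by simpa using hr
    rw [HeightOneSpectrum.intValuation_eq_exp_neg_multiplicity _ hr,
      HeightOneSpectrum.intValuation_eq_exp_neg_multiplicity _ hr']
    congr 3
    apply multiplicity_eq_of_emultiplicity_eq
    rw [emultiplicity_eq_emultiplicity_iff]
    intro n
    rw [Ideal.dvd_span_singleton, Ideal.dvd_span_singleton]
    exact mem_pullPlace_pow σ v n r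

theorem valuation_pullPlace (σ : F ≃+* F) (v : HeightOneSpectrum (𝓞 F)) (x : F) :
    (pullPlace σ v).valuation F x = v.valuation F (σ x) := by
  obtain ⟨a, b, hb, rfl⟩ := IsFractionRing.div_surjective (A := 𝓞 F) x
  have h (r : 𝓞 F) : σ (algebraMap (𝓞 F) F r) =
      algebraMap (𝓞 F) F (RingOfIntegers.mapRingEquiv σ r) := rfl
  rw [map_div₀, map_div₀, map_div₀, h, h, HeightOneSpectrum.valuation_of_algebraMap,
    HeightOneSpectrum.valuation_of_algebraMap, HeightOneSpectrum.valuation_of_algebraMap,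
    HeightOneSpectrum.valuation_of_algebraMap, intValuation_pullPlace, intValuation_pullPlace]

theorem continuous_withValMap (σ : F ≃+* F) (v : HeightOneSpectrum (𝓞 F)) :
    Continuous (WithVal.map ((pullPlace σ v).valuation F) (v.valuation F) (σ : F →+* F)) := by
  refine continuous_of_continuousAt_zero _ ?_
  simp_rw [ContinuousAt, map_zero, (Valued.hasBasis_nhds_zero _ _).tendsto_iff
    (Valued.hasBasis_nhds_zero _ _), true_and, forall_const]
  intro γ
  obtain ⟨r, s, hr, hs, hrs⟩ := Valuation.exists_div_eq_of_unit Valued.v γ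
  have hy : Valued.v.restrict (r / s) = γ.1 := by rw [map_div₀, hrs]
  have hy0 : r / s ≠ 0 := by
    intro h
    rw [h, map_zero] at hy
    exact γ.ne_zero hy.symm
  have key (z : F) : (Valued.v (WithVal.toVal ((pullPlace σ v).valuation F) z)) =
      Valued.v (WithVal.toVal (v.valuation F) (σ z)) := valuation_pullPlace σ v z
  have hy' : Valued.v.restrict
      (WithVal.toVal ((pullPlace σ v).valuation F) (σ.symm (r / s).ofVal)) ≠ 0 := by
    rw [Valuation.ne_zero_iff]
    intro h
    apply hy0
    have := congrArg (fun t ↦ σ (WithVal.ofVal t)) h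
    simpa using this
  refine ⟨Units.mk0 _ hy', fun x hx ↦ ?_⟩
  rw [Set.mem_ofPred_eq, Units.val_mk0, Valuation.restrict_lt_iff, key, key,
    σ.apply_symm_apply] at hx
  rw [Set.mem_ofPred_eq, ← hy, Valuation.restrict_lt_iff]
  exact hx

/-- The continuous extension `F_{σ⁻¹ v} → F_v` of `σ : F → F`. -/
def localMap (σ : F ≃+* F) (v : HeightOneSpectrum (𝓞 F)) :
    (pullPlace σ v).adicCompletion F →+* v.adicCompletion F :=
  (HeightOneSpectrum.adicCompletion.equiv F v).symm.toRingHom.comp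
    ((UniformSpace.Completion.mapRingHom _ (continuous_withValMap σ v)).comp
      (HeightOneSpectrum.adicCompletion.equiv F (pullPlace σ v)).toRingHom)

theorem localMap_coe (σ : F ≃+* F) (v : HeightOneSpectrum (𝓞 F)) (x : F) :
    localMap σ v (x : (pullPlace σ v).adicCompletion F) = ((σ x : F) : v.adicCompletion F) := by
  apply HeightOneSpectrum.adicCompletion.ext
  exact UniformSpace.Completion.mapRingHom_coe (continuous_withValMap σ v) _

theorem continuous_localMap (σ : F ≃+* F) (v : HeightOneSpectrum (𝓞 F)) :
    Continuous (localMap σ v) :=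
  (HeightOneSpectrum.adicCompletion.continuous_ofCompletion F v).comp
    (UniformSpace.Completion.continuous_map.comp
      (HeightOneSpectrum.adicCompletion.continuous_toCompletion F (pullPlace σ v)))

theorem valued_localMap (σ : F ≃+* F) (v : HeightOneSpectrum (𝓞 F))
    (x : (pullPlace σ v).adicCompletion F) : Valued.v (localMap σ v x) = Valued.v x := by
  rcases eq_or_ne x 0 with rfl | hx
  · rw [map_zero, map_zero, map_zero]
  have h1 : {y | Valued.v y = Valued.v x} ∈ nhds x :=
    Valued.locally_const ((Valuation.ne_zero_iff _).2 hx)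
  have h2 : {y | Valued.v (localMap σ v y) = Valued.v (localMap σ v x)} ∈ nhds x :=
    (continuous_localMap σ v).continuousAt
      (Valued.locally_const ((Valuation.ne_zero_iff _).2 ((map_ne_zero _).2 hx)))
  obtain ⟨k, hk⟩ := (HeightOneSpectrum.denseRange_algebraMap F (pullPlace σ v)).mem_nhds
    (Filter.inter_mem h1 h2)
  have hk1 : Valued.v (algebraMap F ((pullPlace σ v).adicCompletion F) k) = Valued.v x := hk.1
  have hk2 : Valued.v (localMap σ v (algebraMap F ((pullPlace σ v).adicCompletion F) k)) =
    Valued.v (localMap σ v x) := hk.2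
  have hk3 : localMap σ v (algebraMap F ((pullPlace σ v).adicCompletion F) k) =
    ((σ k : F) : v.adicCompletion F) := localMap_coe σ v k
  have hk4 : algebraMap F ((pullPlace σ v).adicCompletion F) k =
    (k : (pullPlace σ v).adicCompletion F) := rfl
  rw [← hk2, ← hk1, hk3, hk4, HeightOneSpectrum.adicCompletion.valued_coe,
    HeightOneSpectrum.adicCompletion.valued_coe, valuation_pullPlace]

theorem tendsto_pullPlace (σ : F ≃+* F) :
    Filter.Tendsto (pullPlace σ) Filter.cofinite Filter.cofinite :=
  (HeightOneSpectrum.equivOfRingEquiv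
    (RingOfIntegers.mapRingEquiv σ)).symm.injective.tendsto_cofinite

/-- `σ` on the finite adeles: `(σ x)_v = σ (x_{σ⁻¹ v})`. -/
def finiteAdeleMap (σ : F ≃+* F) : FiniteAdeleRing (𝓞 F) F →+* FiniteAdeleRing (𝓞 F) F :=
  RestrictedProduct.mapAlongRingHom (fun v : HeightOneSpectrum (𝓞 F) ↦ v.adicCompletion F)
    (fun v : HeightOneSpectrum (𝓞 F) ↦ v.adicCompletion F) (pullPlace σ) (tendsto_pullPlace σ)
    (localMap σ) (.of_forall fun v x hx ↦ (valued_localMap σ v x).trans_le hx)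

theorem continuous_finiteAdeleMap (σ : F ≃+* F) : Continuous (finiteAdeleMap σ) :=
  RestrictedProduct.mapAlong_continuous (fun v : HeightOneSpectrum (𝓞 F) ↦ v.adicCompletion F)
    (fun v : HeightOneSpectrum (𝓞 F) ↦ v.adicCompletion F) (pullPlace σ) (tendsto_pullPlace σ)
    (fun v ↦ localMap σ v) (.of_forall fun v x hx ↦ (valued_localMap σ v x).trans_le hx)
    (continuous_localMap σ)

theorem isometry_withAbsMap (σ : F ≃+* F) (v : InfinitePlace F) :
    Isometry ((WithAbs.equiv v.1).symm.toRingHom.comp ((σ : F →+* F).comp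
      (WithAbs.equiv (v.comap (σ : F →+* F)).1).toRingHom)) :=
  AddMonoidHomClass.isometry_of_norm _ fun _ ↦ rfl

/-- The continuous extension `F_{σ⁻¹ v} → F_v` of `σ : F → F` at an infinite place. -/
def infiniteLocalMap (σ : F ≃+* F) (v : InfinitePlace F) :
    (v.comap (σ : F →+* F)).Completion →+* v.Completion :=
  (InfinitePlace.Completion.equiv v).symm.toRingHom.comp
    ((isometry_withAbsMap σ v).mapRingHom.comp
      (InfinitePlace.Completion.equiv (v.comap (σ : F →+* F))).toRingHom)

theorem infiniteLocalMap_coe (σ : F ≃+* F) (v : InfinitePlace F) (x : F) :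
    infiniteLocalMap σ v (x : (v.comap (σ : F →+* F)).Completion) =
      ((σ x : F) : v.Completion) := by
  apply InfinitePlace.Completion.ext
  exact (isometry_withAbsMap σ v).mapRingHom_coe _

theorem continuous_infiniteLocalMap (σ : F ≃+* F) (v : InfinitePlace F) :
    Continuous (infiniteLocalMap σ v) :=
  (InfinitePlace.Completion.continuous_ofCompletion v).comp
    ((isometry_withAbsMap σ v).isometry_mapRingHom.continuous.comp
      (InfinitePlace.Completion.continuous_toCompletion _))

/-- `σ` on the infinite adeles: `(σ x)_v = σ (x_{σ⁻¹ v})`. -/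
def infiniteAdeleMap (σ : F ≃+* F) : InfiniteAdeleRing F →+* InfiniteAdeleRing F :=
  RingHom.pi fun v ↦ (infiniteLocalMap σ v).comp
    (Pi.evalRingHom (fun w : InfinitePlace F ↦ w.Completion) (v.comap (σ : F →+* F)))

theorem continuous_infiniteAdeleMap (σ : F ≃+* F) : Continuous (infiniteAdeleMap σ) :=
  continuous_pi fun v ↦ (continuous_infiniteLocalMap σ v).comp (continuous_apply _)

/-- The action of an automorphism `σ` of `F` on the adele ring of `F`. -/
def adeleMap (σ : F ≃+* F) : AdeleRing (𝓞 F) F →+* AdeleRing (𝓞 F) F :=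
  RingHom.prodMap (infiniteAdeleMap σ) (finiteAdeleMap σ)

theorem continuous_adeleMap (σ : F ≃+* F) : Continuous (adeleMap σ) :=
  (continuous_infiniteAdeleMap σ).prodMap (continuous_finiteAdeleMap σ)

theorem adeleMap_algebraMap (σ : F ≃+* F) (x : F) :
    adeleMap σ (algebraMap F (AdeleRing (𝓞 F) F) x) = algebraMap F (AdeleRing (𝓞 F) F) (σ x) :=
  Prod.ext (funext fun v ↦ infiniteLocalMap_coe σ v x)
    (FiniteAdeleRing.ext F fun v ↦ localMap_coe σ v x)

end AdeleAction

/-! ### Hecke characters -/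

variable (F : Type*) [Field F] [NumberField F]

/-- The group of ideles of `F`, with the idele topology. -/
abbrev Ideles : Type _ := (AdeleRing (𝓞 F) F)ˣ

/-- The diagonal embedding of the multiplicative group of `F` into the ideles. -/
def principalIdele : Fˣ →* Ideles F :=
  Units.map (algebraMap F (AdeleRing (𝓞 F) F) : F →* AdeleRing (𝓞 F) F)

/-- The Hecke characters of `F` (continuous homomorphisms from the ideles to `ℂˣ` that are trivial
on the principal ideles), as a group under pointwise multiplication. -/
def heckeCharacters : Subgroup (Ideles F →ₜ* ℂˣ) where
  carrier := {χ | ∀ a : Fˣ, χ (principalIdele F a) = 1}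
  mul_mem' {χ ψ} hχ hψ a := by
    change χ _ * ψ _ = 1
    rw [hχ a, hψ a, mul_one]
  one_mem' _ := rfl
  inv_mem' {χ} hχ a := by
    change (χ _)⁻¹ = 1
    rw [hχ a, inv_one]

/-- A Hecke character of `F`. -/
abbrev HeckeCharacter : Type _ := heckeCharacters F

variable {F}

namespace HeckeCharacter

/-- The Hecke character `x ↦ χ (σ x)`. -/
def precomp (σ : F ≃+* F) (χ : HeckeCharacter F) : HeckeCharacter F :=
  ⟨χ.1.comp ⟨Units.map (adeleMap σ : AdeleRing (𝓞 F) F →* AdeleRing (𝓞 F) F),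
      (continuous_adeleMap σ).units_map (adeleMap σ : AdeleRing (𝓞 F) F →* AdeleRing (𝓞 F) F)⟩,
    fun a ↦ by
      refine Eq.trans (congrArg χ.1 ?_) (χ.2 (Units.map (σ : F →* F) a))
      exact Units.ext (adeleMap_algebraMap σ a)⟩

/-- The complex conjugate character `x ↦ conj (χ x)`. -/
def bar (χ : HeckeCharacter F) : HeckeCharacter F :=
  ⟨ContinuousMonoidHom.comp ⟨Units.map (starRingEnd ℂ : ℂ →* ℂ),
      Complex.continuous_conj.units_map (starRingEnd ℂ : ℂ →* ℂ)⟩ χ.1,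
    fun a ↦ by
      change Units.map (starRingEnd ℂ : ℂ →* ℂ) (χ.1 (principalIdele F a)) = 1
      rw [χ.2 a, map_one]⟩

/-- `χ` is unramified at the finite place `v`: it is trivial on the units of `𝓞_v`, seen as
the ideles that are `1` at all other places. -/
def IsUnramifiedAt (χ : HeckeCharacter F) (v : HeightOneSpectrum (𝓞 F)) : Prop :=
  ∀ x : Ideles F, x.val.1 = 1 → (∀ w, w ≠ v → x.val.2 w = 1) → Valued.v (x.val.2 v) = 1 →
    χ.1 x = 1

/-- `χ` is trivial on the group of ideles `x` with `x_v = 1` at the infinite places, and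
`x_v ∈ 𝓞_vˣ`, `x_v ≡ 1 mod I 𝓞_v` at all finite places `v`. -/
def HasLevel (χ : HeckeCharacter F) (I : Ideal (𝓞 F)) : Prop :=
  ∀ x : Ideles F, x.val.1 = 1 →
    (∀ v : HeightOneSpectrum (𝓞 F), Valued.v (x.val.2 v) = 1 ∧
      ∃ y ∈ I.map (algebraMap (𝓞 F) (v.adicCompletionIntegers F)),
        (y : v.adicCompletion F) = x.val.2 v - 1) →
    χ.1 x = 1

/-- The conductor of `χ`: the largest ideal `I` such that `χ` has level `I`. -/
def conductor (χ : HeckeCharacter F) : Ideal (𝓞 F) := sSup {I | χ.HasLevel I}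

end HeckeCharacter

/-! ### Infinity types -/

theorem isometry_embedding_mk (ι : F →+* ℂ) :
    Isometry (ι.comp (WithAbs.equiv (InfinitePlace.mk ι).1).toRingHom) :=
  AddMonoidHomClass.isometry_of_norm _ fun _ ↦ rfl

/-- The continuous extension to `F_v` of a complex embedding `ι` of `F`, where `v` is the infinite
place defined by `ι`. -/
def embeddingExtension (ι : F →+* ℂ) : (InfinitePlace.mk ι).Completion →+* ℂ :=
  (isometry_embedding_mk ι).extensionHom.comp
    (InfinitePlace.Completion.equiv (InfinitePlace.mk ι)).toRingHom

/-- For `F` imaginary quadratic, with its infinite completion identified with `ℂ` through `ι`: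
`χ` has infinity type `z ^ m * conj z ^ n`. -/
def HeckeCharacter.HasInfinityType (ι : F →+* ℂ) (χ : HeckeCharacter F) (m n : ℤ) : Prop :=
  ∀ x : Ideles F, x.val.2 = 1 →
    ((χ.1 x : ℂˣ) : ℂ) = embeddingExtension ι (x.val.1 (InfinitePlace.mk ι)) ^ m *
      (starRingEnd ℂ (embeddingExtension ι (x.val.1 (InfinitePlace.mk ι)))) ^ n

/-! ### Imaginary quadratic fields -/

variable (F) in
/-- The complex conjugation of an imaginary quadratic field `F`. -/
def conjugation [Algebra.IsQuadraticExtension ℚ F] [IsTotallyComplex F] : F ≃+* F :=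
  haveI : IsCMField F := IsCMField.ofCMExtension ℚ F
  (IsCMField.complexConj F).toRingEquiv

/-- The character `χ^c`, given by `χ^c (x) = χ (conj x)`. -/
def HeckeCharacter.conj [Algebra.IsQuadraticExtension ℚ F] [IsTotallyComplex F]
    (χ : HeckeCharacter F) : HeckeCharacter F :=
  χ.precomp (conjugation F)

/-- The set of (finite) places of `F` dividing the conductors of `φ₁` and `φ₂`, or the complex
conjugates of these conductors, or `p * d_F`. -/
def badPlaces [Algebra.IsQuadraticExtension ℚ F] [IsTotallyComplex F] (p : ℕ)
    (φ₁ φ₂ : HeckeCharacter F) : Set (HeightOneSpectrum (𝓞 F)) :=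
  {v | v.asIdeal ∣ φ₁.conductor ∨ v.asIdeal ∣ φ₂.conductor ∨
    v.asIdeal ∣ φ₁.conductor.map (RingOfIntegers.mapRingEquiv (conjugation F)) ∨
    v.asIdeal ∣ φ₂.conductor.map (RingOfIntegers.mapRingEquiv (conjugation F)) ∨
    v.asIdeal ∣ Ideal.span {((p * discr F : ℤ) : 𝓞 F)}}

end HeckeTwist

end

/-!
Write `c` for complex conjugation, `ψ = φ₁ φ₂` and `χ = φ₁ / φ₂`. The hypothesis `χ ^ c = conj χ`
says that `χ χ ^ c = |χ| ^ 2`, so that `θ = φ₁ / (φ₂ ^ c |χ|)` satisfies `θ ^ 2 = ψ / ψ ^ c` and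
`θ θ ^ c = 1`. At infinity `φ₁ / φ₂ ^ c` is `z * conj z` and `|χ|` is `|z ^ 2|`, so `θ` is trivial
there. It suffices to find `η` of finite order with `θ = η ^ c / η`, ramified only at the given
places (`exists_conj_div_eq`).

Such an `η` has to satisfy `η (x ^ c / x) = θ x`. Since `ℂˣ` is divisible, a character `η` of a ray
class group with this property exists as soon as `θ` is trivial on the ideles `x` for which
`x ^ c / x` is trivial in the ray class group (`exists_apply_div_eq`); it has finite order because
ray class groups have finite exponent (`exists_pow_div_mem_congruenceSubgroup`). For such `x`, write
`x ^ c / x = a u` with `a` in the field and `u` in a congruence subgroup. Norms from an imaginary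
quadratic field are positive, so `a` and `u` both have norm one (`mul_conjugation_eq_one`), and
Hilbert 90 gives `a = b ^ c / b` in the field and `u = w ^ c / w` in a slightly larger congruence
subgroup (`exists_conjIdele_eq_mul`); the latter uses that the places without congruence condition
are unramified over `ℚ`. As `θ` is trivial on `b` and `w`, it remains to treat the ideles
`y = x / (b w)`, whose finite components are invariant under `c` (`eq_one_of_conjIdele_div_mem`).

On invariant ideles `θ` is trivial (`eq_one_of_conjIdele_eq`). Indeed, `θ` is trivial on norms
`z z ^ c`. Strong approximation gives a rational number close to `y`, and Dirichlet's theorem with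
quadratic reciprocity (`exists_prime_isSquare`) allows to change the rational number, up to sign and
in its residue class, so that its part prime to the level is a prime that splits in `F`. So `y` is
a principal idele times a norm times an element of a congruence subgroup. The sign is available
because `θ` is trivial at infinity and the quadratic character of `F` is odd.
-/

noncomputable section

namespace HeckeTwist

/-! ### Components of ideles -/

section Components

variable {F : Type*} [Field F] [NumberField F]

theorem valued_algebraMap (v : HeightOneSpectrum (𝓞 F)) (k : F) :
    Valued.v (algebraMap F (v.adicCompletion F) k) = v.valuation F k :=
  HeightOneSpectrum.valuedAdicCompletion_eq_valuation' v k

theorem valued_natCast (v : HeightOneSpectrum (𝓞 F)) (n : ℕ) :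
    Valued.v (n : v.adicCompletion F) = v.intValuation (n : 𝓞 F) := by
  rw [← map_natCast (algebraMap F (v.adicCompletion F)), valued_algebraMap,
    ← map_natCast (algebraMap (𝓞 F) F), HeightOneSpectrum.valuation_of_algebraMap]

theorem valued_natCast_le_one (v : HeightOneSpectrum (𝓞 F)) (n : ℕ) :
    Valued.v (n : v.adicCompletion F) ≤ 1 := by
  rw [valued_natCast]
  exact v.intValuation_le_one _

theorem valued_natCast_ne_zero (v : HeightOneSpectrum (𝓞 F)) {n : ℕ} (hn : n ≠ 0) :
    Valued.v (n : v.adicCompletion F) ≠ 0 := by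
  rw [valued_natCast]
  exact v.intValuation_ne_zero _ (Nat.cast_ne_zero.2 hn)

theorem valued_natCast_le_of_dvd (v : HeightOneSpectrum (𝓞 F)) {m n : ℕ} (h : m ∣ n) :
    Valued.v (n : v.adicCompletion F) ≤ Valued.v (m : v.adicCompletion F) := by
  obtain ⟨k, rfl⟩ := h
  rw [Nat.cast_mul, map_mul]
  exact mul_le_of_le_one_right' (valued_natCast_le_one v k)

theorem finite_valued_ne_one {n : ℕ} (hn : n ≠ 0) :
    {v : HeightOneSpectrum (𝓞 F) | Valued.v (n : v.adicCompletion F) ≠ 1}.Finite := by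
  refine (HeightOneSpectrum.Support.finite (𝓞 F) ((n : F)⁻¹)).subset fun v hv ↦ ?_
  have h : v.valuation F ((n : F)⁻¹) = (Valued.v (n : v.adicCompletion F))⁻¹ := by
    rw [map_inv₀, ← valued_algebraMap, map_natCast]
  change 1 < v.valuation F ((n : F)⁻¹)
  rw [h]
  exact (one_lt_inv₀ (zero_lt_iff.2 (valued_natCast_ne_zero v hn))).2
    (lt_of_le_of_ne (valued_natCast_le_one v n) hv)

/-- Every place divides a rational prime, so that natural numbers are arbitrarily small at it. -/
theorem exists_natCast_valued_le (v : HeightOneSpectrum (𝓞 F)) {γ : WithZero (Multiplicative ℤ)}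
    (hγ : γ ≠ 0) : ∃ n : ℕ, n ≠ 0 ∧ Valued.v (n : v.adicCompletion F) ≤ γ := by
  obtain ⟨m, rfl⟩ : ∃ m : ℤ, WithZero.exp m = γ := ⟨WithZero.log γ, WithZero.exp_log hγ⟩
  obtain ⟨p, hp0, hp⟩ : ∃ p : ℕ, p ≠ 0 ∧ (p : 𝓞 F) ∈ v.asIdeal := by
    refine ⟨Ideal.absNorm v.asIdeal, ?_, Ideal.absNorm_mem _⟩
    rw [Ne, Ideal.absNorm_eq_zero_iff]
    exact v.ne_bot
  refine ⟨p ^ m.natAbs, pow_ne_zero _ hp0, ?_⟩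
  rw [valued_natCast, Nat.cast_pow]
  refine ((v.intValuation_le_pow_iff_mem _ _).2 (Ideal.pow_mem_pow hp _)).trans ?_
  rw [WithZero.exp_le_exp]
  omega

theorem exists_natCast_valued_le_of_finite {T : Set (HeightOneSpectrum (𝓞 F))} (hT : T.Finite)
    (γ : HeightOneSpectrum (𝓞 F) → WithZero (Multiplicative ℤ)) (hγ : ∀ v ∈ T, γ v ≠ 0) :
    ∃ n : ℕ, n ≠ 0 ∧ ∀ v ∈ T, Valued.v (n : v.adicCompletion F) ≤ γ v := by
  induction T, hT using Set.Finite.induction_on with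
  | empty => exact ⟨1, one_ne_zero, by simp⟩
  | @insert a s _ _ ih =>
    obtain ⟨n, hn, h⟩ := ih fun v hv ↦ hγ v (.inr hv)
    obtain ⟨m, hm, h'⟩ := exists_natCast_valued_le a (hγ a (.inl rfl))
    refine ⟨m * n, mul_ne_zero hm hn, fun v hv ↦ ?_⟩
    rcases hv with rfl | hv
    · exact (valued_natCast_le_of_dvd v (dvd_mul_right m n)).trans h'
    · exact (valued_natCast_le_of_dvd v (dvd_mul_left n m)).trans (h v hv)

theorem component_ne_zero (x : Ideles F) (v : HeightOneSpectrum (𝓞 F)) : x.val.2 v ≠ 0 := by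
  intro h
  have h1 : x.val.2 v * x.inv.2 v = 1 :=
    congrArg (fun a : AdeleRing (𝓞 F) F ↦ a.2 v) x.val_inv
  rw [h, zero_mul] at h1
  exact zero_ne_one h1

/-- The component of ideles at a finite place, as a homomorphism. -/
def component (v : HeightOneSpectrum (𝓞 F)) : Ideles F →* (v.adicCompletion F)ˣ where
  toFun x := Units.mk0 (x.val.2 v) (component_ne_zero x v)
  map_one' := Units.ext rfl
  map_mul' _ _ := Units.ext rfl

theorem component_inv (x : Ideles F) (v : HeightOneSpectrum (𝓞 F)) :
    (x⁻¹).val.2 v = (x.val.2 v)⁻¹ := by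
  have h := congrArg Units.val (map_inv (component v) x)
  rwa [Units.val_inv_eq_inv_val] at h

theorem component_div (x y : Ideles F) (v : HeightOneSpectrum (𝓞 F)) :
    (x / y).val.2 v = x.val.2 v / y.val.2 v := by
  rw [div_eq_mul_inv, div_eq_mul_inv, ← component_inv]
  rfl

theorem eventually_valued_component (x : Ideles F) :
    ∀ᶠ v in Filter.cofinite, Valued.v (x.val.2 v) = 1 :=
  (FiniteAdeleRing.isUnit_iff.1 (x.isUnit.map (RingHom.snd (InfiniteAdeleRing F)
    (FiniteAdeleRing (𝓞 F) F)))).2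

/-- The idele with components `1` at the infinite places and prescribed components at the finite
places, almost all of them units. -/
def finiteIdele (f : ∀ v : HeightOneSpectrum (𝓞 F), v.adicCompletion F) (h0 : ∀ v, f v ≠ 0)
    (h1 : ∀ᶠ v in Filter.cofinite, Valued.v (f v) = 1) : Ideles F :=
  (Prod.isUnit_iff.2 ⟨isUnit_one, FiniteAdeleRing.isUnit_iff
    (a := (⟨f, h1.mono fun _ h ↦ h.le⟩ : FiniteAdeleRing (𝓞 F) F)) |>.2 ⟨h0, h1⟩⟩ :
    IsUnit ((1, ⟨f, h1.mono fun _ h ↦ h.le⟩) : AdeleRing (𝓞 F) F)).unit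

variable (F) in
/-- The ideles that are units at every finite place and congruent to `1` modulo `N` at the finite
places in `S`; their infinite components are arbitrary. -/
def congruenceSubgroup (N : ℕ) (S : Set (HeightOneSpectrum (𝓞 F))) : Subgroup (Ideles F) where
  carrier := {x | ∀ v, Valued.v (x.val.2 v) = 1 ∧
    (v ∈ S → Valued.v (x.val.2 v - 1) ≤ Valued.v (N : v.adicCompletion F))}
  mul_mem' {x y} hx hy v := by
    have h : (x * y).val.2 v = x.val.2 v * y.val.2 v := rfl
    rw [h]
    refine ⟨by rw [map_mul, (hx v).1, (hy v).1, one_mul], fun hv ↦ ?_⟩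
    have h2 : x.val.2 v * y.val.2 v - 1 = x.val.2 v * (y.val.2 v - 1) + (x.val.2 v - 1) := by ring
    rw [h2]
    refine Valuation.map_add_le _ ?_ ((hx v).2 hv)
    rw [map_mul, (hx v).1, one_mul]
    exact (hy v).2 hv
  one_mem' v := by
    have h : (1 : Ideles F).val.2 v = 1 := rfl
    rw [h]
    refine ⟨map_one _, fun _ ↦ ?_⟩
    rw [sub_self, map_zero]
    exact zero_le
  inv_mem' {x} hx v := by
    rw [component_inv]
    refine ⟨by rw [map_inv₀, (hx v).1, inv_one], fun hv ↦ ?_⟩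
    have h2 : (x.val.2 v)⁻¹ - 1 = -((x.val.2 v)⁻¹ * (x.val.2 v - 1)) := by
      have := component_ne_zero x v
      field_simp
      ring
    rw [h2, Valuation.map_neg, map_mul, map_inv₀, (hx v).1, inv_one, one_mul]
    exact (hx v).2 hv

theorem congruenceSubgroup_anti {M N : ℕ} (h : M ∣ N) {S T : Set (HeightOneSpectrum (𝓞 F))}
    (hST : S ⊆ T) : congruenceSubgroup F N T ≤ congruenceSubgroup F M S :=
  fun _ hx v ↦ ⟨(hx v).1, fun hv ↦ ((hx v).2 (hST hv)).trans (valued_natCast_le_of_dvd v h)⟩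

end Components

/-! ### Topology of the idele group -/

section Topology

variable {F : Type*} [Field F] [NumberField F]

theorem isOpen_congruenceSubgroup {N : ℕ} (hN : N ≠ 0) (S : Set (HeightOneSpectrum (𝓞 F))) :
    IsOpen (congruenceSubgroup F N S : Set (Ideles F)) := by
  refine Subgroup.isOpen_mono (congruenceSubgroup_anti dvd_rfl (Set.subset_univ S)) ?_
  let g : FiniteAdeleRing (𝓞 F) F → FiniteAdeleRing (𝓞 F) F :=
    fun a ↦ algebraMap F (FiniteAdeleRing (𝓞 F) F) (N : F)⁻¹ * (a - 1)
  have hg : Continuous g := by fun_prop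
  let O : Set (FiniteAdeleRing (𝓞 F) F) := {a | ∀ v, a v ∈ v.adicCompletionIntegers F}
  have hO : IsOpen O := RestrictedProduct.isOpen_forall_mem
    (R := fun v : HeightOneSpectrum (𝓞 F) ↦ v.adicCompletion F)
    (A := fun v ↦ (v.adicCompletionIntegers F : Set (v.adicCompletion F)))
    fun v ↦ Valued.isOpen_valuationSubring _
  have key (a : FiniteAdeleRing (𝓞 F) F) (v : HeightOneSpectrum (𝓞 F)) :
      g a v ∈ v.adicCompletionIntegers F ↔
        Valued.v (a v - 1) ≤ Valued.v (N : v.adicCompletion F) := by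
    have h : g a v = (N : v.adicCompletion F)⁻¹ * (a v - 1) := by
      change algebraMap F (v.adicCompletion F) (N : F)⁻¹ * (a v - 1) = _
      rw [map_inv₀, map_natCast]
    rw [HeightOneSpectrum.mem_adicCompletionIntegers, h, map_mul, map_inv₀,
      inv_mul_le_iff₀ (zero_lt_iff.2 (valued_natCast_ne_zero v hN)), mul_one]
  have hO' (w : Ideles F → Ideles F) (hw : Continuous w) :
      IsOpen {x : Ideles F | g (w x).val.2 ∈ O} :=
    hO.preimage (hg.comp (continuous_snd.comp
      ((Units.continuous_val (M := AdeleRing (𝓞 F) F)).comp hw)))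
  have hU := (hO' id continuous_id).inter (hO' (·⁻¹) continuous_inv)
  convert! hU
  ext x
  simp only [Set.mem_inter_iff, Set.mem_ofPred_eq, O, key, SetLike.mem_coe, id]
  refine ⟨fun h ↦ ⟨fun v ↦ (h v).2 trivial, fun v ↦ (inv_mem h v).2 trivial⟩, fun h v ↦
    ⟨le_antisymm ?_ ?_, fun _ ↦ h.1 v⟩⟩
  · rw [← sub_add_cancel (x.val.2 v) 1]
    exact Valuation.map_add_le _ ((h.1 v).trans (valued_natCast_le_one v N)) (map_one _).le
  · have h2 : Valued.v ((x⁻¹).val.2 v) ≤ 1 := by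
      rw [← sub_add_cancel ((x⁻¹).val.2 v) 1]
      exact Valuation.map_add_le _ ((h.2 v).trans (valued_natCast_le_one v N)) (map_one _).le
    rw [component_inv, map_inv₀] at h2
    exact (inv_le_one₀ (zero_lt_iff.2 ((Valuation.ne_zero_iff _).2 (component_ne_zero x v)))).1 h2

/-- A neighbourhood of `1` in a completion contains a ball around `1` whose radius is the absolute
value of a natural number. -/
theorem exists_natCast_ball_subset (v : HeightOneSpectrum (𝓞 F)) {s : Set (v.adicCompletion F)}
    (hs : s ∈ nhds 1) : ∃ n : ℕ, n ≠ 0 ∧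
      ∀ x, Valued.v (x - 1) ≤ Valued.v (n : v.adicCompletion F) → x ∈ s := by
  obtain ⟨γ, hγ⟩ := Valued.mem_nhds.1 hs
  obtain ⟨r, t, hr, ht, hrt⟩ := Valuation.exists_div_eq_of_unit Valued.v γ
  have hy : Valued.v.restrict (r / t) = γ.1 := by rw [map_div₀, hrt]
  have hy0 : r / t ≠ 0 := by
    intro h
    rw [h, map_zero] at hy
    exact γ.ne_zero hy.symm
  -- dividing by a uniformizer turns the strict inequality into a weak one
  obtain ⟨n, hn, hn'⟩ := exists_natCast_valued_le v
    (γ := Valued.v (r / t) * WithZero.exp (-1 : ℤ))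
    (mul_ne_zero ((Valuation.ne_zero_iff _).2 hy0) (by simp))
  refine ⟨n, hn, fun x hx ↦ hγ ?_⟩
  rw [Set.mem_ofPred_eq, ← hy, Valuation.restrict_lt_iff]
  refine (hx.trans hn').trans_lt (mul_lt_of_lt_one_right ?_ ?_)
  · exact zero_lt_iff.2 ((Valuation.ne_zero_iff _).2 hy0)
  · rw [← WithZero.exp_zero, WithZero.exp_lt_exp]
    norm_num

/-- Every neighbourhood of `1` contains the ideles with trivial infinite components that are
congruent to `1` modulo some nonzero integer. -/
theorem exists_congruenceSubgroup_subset {V : Set (Ideles F)} (hV : V ∈ nhds 1) :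
    ∃ N : ℕ, N ≠ 0 ∧ ∀ x ∈ congruenceSubgroup F N Set.univ, x.val.1 = 1 → x ∈ V := by
  obtain ⟨A, hA, hAV⟩ : ∃ A ∈ nhds (1 : AdeleRing (𝓞 F) F),
      ∀ x : Ideles F, x.val ∈ A → (x⁻¹).val ∈ A → x ∈ V := by
    rw [(Units.isInducing_embedProduct (M := AdeleRing (𝓞 F) F)).nhds_eq_comap,
      Filter.mem_comap] at hV
    obtain ⟨U, hU, hUV⟩ := hV
    rw [map_one, Prod.one_eq_mk, mem_nhds_prod_iff] at hU
    obtain ⟨s, hs, t, ht, hst⟩ := hU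
    exact ⟨s ∩ MulOpposite.op ⁻¹' t,
      Filter.inter_mem hs (MulOpposite.continuous_op.continuousAt ht),
      fun x hx hx' ↦ hUV (hst ⟨hx.1, hx'.2⟩)⟩
  -- on integral adeles the restricted product topology is the product topology
  let j : (∀ v : HeightOneSpectrum (𝓞 F), v.adicCompletionIntegers F) → AdeleRing (𝓞 F) F :=
    fun y ↦ ((1 : InfiniteAdeleRing F), RestrictedProduct.structureMap
      (fun v : HeightOneSpectrum (𝓞 F) ↦ v.adicCompletion F)
      (fun v ↦ (v.adicCompletionIntegers F : Set (v.adicCompletion F))) Filter.cofinite y)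
  have hj : Continuous j := continuous_const.prodMk
    RestrictedProduct.isEmbedding_structureMap.continuous
  have hA' : j ⁻¹' A ∈ nhds 1 := hj.continuousAt hA
  rw [nhds_pi, Filter.mem_pi] at hA'
  obtain ⟨T, hT, s, hs, hsA⟩ := hA'
  have h1 (v : HeightOneSpectrum (𝓞 F)) : ∃ n : ℕ, n ≠ 0 ∧ ∀ x : v.adicCompletionIntegers F,
      Valued.v ((x : v.adicCompletion F) - 1) ≤ Valued.v (n : v.adicCompletion F) → x ∈ s v := by
    obtain ⟨s', hs', hss⟩ := (mem_nhds_subtype _ _ _).1 (hs v)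
    obtain ⟨n, hn, h⟩ := exists_natCast_ball_subset v hs'
    exact ⟨n, hn, fun x hx ↦ hss (h _ hx)⟩
  choose n hn hns using h1
  obtain ⟨N, hN, hNT⟩ := exists_natCast_valued_le_of_finite hT
    (fun v ↦ Valued.v (n v : v.adicCompletion F)) fun v _ ↦ valued_natCast_ne_zero v (hn v)
  have key (x : Ideles F) (hx : x ∈ congruenceSubgroup F N Set.univ) (hx1 : x.val.1 = 1) :
      x.val ∈ A := by
    let y : ∀ v : HeightOneSpectrum (𝓞 F), v.adicCompletionIntegers F :=
      fun v ↦ ⟨x.val.2 v, (hx v).1.le⟩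
    have h2 : y ∈ j ⁻¹' A :=
      hsA fun v hv ↦ hns v _ (((hx v).2 trivial).trans (hNT v hv))
    have h3 : j y = x.val :=
      Prod.ext hx1.symm (FiniteAdeleRing.ext F fun v ↦ rfl)
    rw [← h3]
    exact h2
  refine ⟨N, hN, fun x hx hx1 ↦ hAV x (key x hx hx1) (key _ (inv_mem hx) ?_)⟩
  have h4 : x.val.1 * (x⁻¹).val.1 = 1 :=
    congrArg (fun a : AdeleRing (𝓞 F) F ↦ a.1) x.val_inv
  rwa [hx1, one_mul] at h4

/-- The multiplicative group of `ℂ` has no small subgroups. -/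
theorem eq_one_of_forall_norm_pow_sub_one_le {z : ℂ} (h : ∀ n : ℕ, ‖z ^ n - 1‖ ≤ 1 / 2) :
    z = 1 := by
  by_contra hz
  have hpos : 0 < ‖z - 1‖ := norm_pos_iff.2 (sub_ne_zero.2 hz)
  -- each squaring expands the distance from `1` by a factor of at least `3 / 2`
  have key (k : ℕ) : (3 / 2 : ℝ) ^ k * ‖z - 1‖ ≤ ‖z ^ (2 ^ k) - 1‖ := by
    induction k with
    | zero => simp
    | succ k ih =>
      have h1 : z ^ (2 ^ (k + 1)) - 1 = (z ^ (2 ^ k) + 1) * (z ^ (2 ^ k) - 1) := by ring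
      have h2 : (3 / 2 : ℝ) ≤ ‖z ^ (2 ^ k) + 1‖ := by
        have h3 : ‖(2 : ℂ)‖ ≤ ‖z ^ (2 ^ k) + 1‖ + ‖z ^ (2 ^ k) - 1‖ := by
          have h4 : (2 : ℂ) = (z ^ (2 ^ k) + 1) - (z ^ (2 ^ k) - 1) := by ring
          conv_lhs => rw [h4]
          exact norm_sub_le _ _
        rw [Complex.norm_ofNat] at h3
        linarith [h (2 ^ k)]
      rw [h1, norm_mul, pow_succ', mul_assoc]
      gcongr
  obtain ⟨k, hk⟩ := pow_unbounded_of_one_lt (1 / 2 / ‖z - 1‖) (by norm_num : (1 : ℝ) < 3 / 2)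
  rw [div_lt_iff₀ hpos] at hk
  linarith [key k, h (2 ^ k)]

/-- A Hecke character has a nonzero level, since `ℂˣ` has no small subgroups. -/
theorem HeckeCharacter.exists_level (χ : HeckeCharacter F) :
    ∃ N : ℕ, N ≠ 0 ∧ ∀ x ∈ congruenceSubgroup F N Set.univ, x.val.1 = 1 → χ.1 x = 1 := by
  have hV : (fun x ↦ ((χ.1 x : ℂˣ) : ℂ)) ⁻¹' Metric.closedBall 1 (1 / 2) ∈ nhds 1 := by
    refine ContinuousAt.preimage_mem_nhds
      (Units.continuous_val.comp χ.1.continuous_toFun).continuousAt ?_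
    have h1 : ((χ.1 1 : ℂˣ) : ℂ) = 1 := by rw [map_one, Units.val_one]
    change Metric.closedBall 1 (1 / 2) ∈ nhds ((χ.1 1 : ℂˣ) : ℂ)
    rw [h1]
    exact Metric.closedBall_mem_nhds _ (by norm_num)
  obtain ⟨N, hN, h⟩ := exists_congruenceSubgroup_subset hV
  refine ⟨N, hN, fun x hx hx1 ↦ Units.ext (eq_one_of_forall_norm_pow_sub_one_le fun n ↦ ?_)⟩
  have h2 := h (x ^ n) (pow_mem hx n) (by
    change x.val.1 ^ n = 1
    rw [hx1, one_pow])
  rw [Set.mem_preimage, Metric.mem_closedBall, dist_eq_norm, map_pow, Units.val_pow_eq_pow_val]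
    at h2
  exact h2

end Topology

/-! ### Strong approximation and finiteness of ray class groups -/

section Approximation

variable {F : Type*} [Field F] [NumberField F]

theorem exists_forall_valued_sub_le_of_integral (x : FiniteAdeleRing (𝓞 F) F)
    (hx : ∀ v, Valued.v (x v) ≤ 1) {M : ℕ} (hM : M ≠ 0) :
    ∃ r : 𝓞 F, ∀ v, Valued.v (x v - algebraMap F (v.adicCompletion F) r) ≤
      Valued.v (M : v.adicCompletion F) := by
  -- local approximations at the finitely many places dividing `M` are combined by the Chinese
  -- remainder theorem
  have hloc (v : HeightOneSpectrum (𝓞 F)) : ∃ r : 𝓞 F,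
      Valued.v (x v - algebraMap F (v.adicCompletion F) r) ≤
        Valued.v (M : v.adicCompletion F) := by
    have hM' := valued_natCast_ne_zero v hM
    have hnhds : {y | Valued.v (y - x v) ≤ Valued.v (M : v.adicCompletion F)} ∈ nhds (x v) := by
      have h1 : Continuous fun y : v.adicCompletion F ↦ y - x v - (M : v.adicCompletion F) :=
        (continuous_id.sub continuous_const).sub continuous_const
      have h2 := h1.continuousAt (x := x v) (Valued.locally_const (x := x v - x v - M) (by
        rwa [sub_self, zero_sub, Valuation.map_neg]))
      filter_upwards [h2] with y hy
      have hy' : Valued.v (y - x v - (M : v.adicCompletion F)) = Valued.v (x v - x v - M) := hy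
      rw [sub_self, zero_sub, Valuation.map_neg] at hy'
      rw [← sub_add_cancel (y - x v) (M : v.adicCompletion F)]
      exact Valuation.map_add_le _ hy'.le le_rfl
    obtain ⟨k, hk⟩ := (HeightOneSpectrum.denseRange_algebraMap F v).mem_nhds hnhds
    have hk1 : v.valuation F k ≤ 1 := by
      rw [← valued_algebraMap, ← sub_add_cancel (algebraMap F (v.adicCompletion F) k) (x v)]
      exact Valuation.map_add_le _ (le_trans hk (valued_natCast_le_one v M)) (hx v)
    obtain ⟨r, hr⟩ := v.exists_valuation_sub_lt_of_integer hk1 (Units.mk0 _ hM')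
    refine ⟨r, ?_⟩
    have h5 : x v - algebraMap F (v.adicCompletion F) r =
        -(algebraMap F (v.adicCompletion F) k - x v) -
          algebraMap F (v.adicCompletion F) (r - k) := by
      rw [map_sub]
      ring
    rw [h5]
    refine Valuation.map_sub_le _ ?_ ?_
    · rw [Valuation.map_neg]
      exact hk
    · rw [valued_algebraMap]
      exact hr.le
  choose r hr using hloc
  let T := (finite_valued_ne_one (F := F) hM).toFinset
  have he (v : HeightOneSpectrum (𝓞 F)) : ∃ e : ℕ,
      WithZero.exp (-(e : ℤ)) ≤ Valued.v (M : v.adicCompletion F) := by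
    refine ⟨(-WithZero.log (Valued.v (M : v.adicCompletion F))).toNat, ?_⟩
    conv_rhs => rw [← WithZero.exp_log (valued_natCast_ne_zero v hM)]
    rw [WithZero.exp_le_exp]
    omega
  choose e he using he
  obtain ⟨y, hy⟩ := IsDedekindDomain.exists_forall_sub_mem_ideal (s := T)
    (fun v : HeightOneSpectrum (𝓞 F) ↦ v.asIdeal) e (fun v _ ↦ v.prime)
    (fun v _ w _ hvw h ↦ hvw (HeightOneSpectrum.ext h)) (fun v ↦ r v)
  refine ⟨y, fun v ↦ ?_⟩
  by_cases hv : v ∈ T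
  · have h1 : x v - algebraMap F (v.adicCompletion F) y =
        (x v - algebraMap F (v.adicCompletion F) (r v)) -
          algebraMap F (v.adicCompletion F) (algebraMap (𝓞 F) F (y - r v)) := by
      rw [map_sub, map_sub]
      ring
    rw [h1]
    refine Valuation.map_sub_le _ (hr v) ?_
    rw [valued_algebraMap, HeightOneSpectrum.valuation_of_algebraMap]
    exact ((v.intValuation_le_pow_iff_mem _ _).2 (hy v hv)).trans (he v)
  · have hv' : Valued.v (M : v.adicCompletion F) = 1 := by
      by_contra h
      exact hv ((finite_valued_ne_one hM).mem_toFinset.2 h)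
    rw [hv']
    refine Valuation.map_sub_le _ (hx v) ?_
    rw [valued_algebraMap]
    exact v.valuation_le_one y

/-- Strong approximation: a number field is dense in its finite adeles. -/
theorem exists_forall_valued_sub_le (x : FiniteAdeleRing (𝓞 F) F) {M : ℕ} (hM : M ≠ 0) :
    ∃ f : F, ∀ v, Valued.v (x v - algebraMap F (v.adicCompletion F) f) ≤
      Valued.v (M : v.adicCompletion F) := by
  have hfin : {v | ¬ Valued.v (x v) ≤ 1}.Finite := x.2
  obtain ⟨k, hk, hkx⟩ := exists_natCast_valued_le_of_finite hfin (fun v ↦ (Valued.v (x v))⁻¹)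
    fun v hv h ↦ hv (by rw [inv_eq_zero] at h; rw [h]; exact zero_le)
  have hint (v : HeightOneSpectrum (𝓞 F)) :
      Valued.v (((k : FiniteAdeleRing (𝓞 F) F) * x) v) ≤ 1 := by
    have h1 : ((k : FiniteAdeleRing (𝓞 F) F) * x) v = (k : v.adicCompletion F) * x v := rfl
    rw [h1, map_mul]
    by_cases hv : Valued.v (x v) ≤ 1
    · exact mul_le_one' (valued_natCast_le_one v k) hv
    · exact (mul_le_mul_left (hkx v hv) _).trans (inv_mul_le_one)
  obtain ⟨r, hr⟩ := exists_forall_valued_sub_le_of_integral _ hint (mul_ne_zero hk hM)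
  refine ⟨r / k, fun v ↦ ?_⟩
  have hk' : (k : v.adicCompletion F) ≠ 0 := by
    intro h
    exact valued_natCast_ne_zero v hk (by rw [h, map_zero])
  have h2 : (k : v.adicCompletion F) * (x v - algebraMap F (v.adicCompletion F) (r / k)) =
      ((k : FiniteAdeleRing (𝓞 F) F) * x) v - algebraMap F (v.adicCompletion F) r := by
    rw [map_div₀, map_natCast, mul_sub, mul_div_cancel₀ _ hk']
    rfl
  have h3 := hr v
  rw [← h2, map_mul, Nat.cast_mul, map_mul] at h3
  exact (mul_le_mul_iff_right₀ (zero_lt_iff.2 (valued_natCast_ne_zero v hk))).1 h3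

/-- The power of a prime ideal with exponent the class number is principal. -/
theorem exists_valuation_eq_exp_card_classGroup (v : HeightOneSpectrum (𝓞 F)) :
    ∃ a : F, a ≠ 0 ∧
      v.valuation F a = WithZero.exp (-(Fintype.card (ClassGroup (𝓞 F)) : ℤ)) ∧
      ∀ w, w ≠ v → w.valuation F a = 1 := by
  set h := Fintype.card (ClassGroup (𝓞 F))
  have h1 : Submodule.IsPrincipal (v.asIdeal ^ h) := by
    have hv : v.asIdeal ∈ nonZeroDivisors (Ideal (𝓞 F)) := mem_nonZeroDivisors_of_ne_zero v.ne_bot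
    rw [← ClassGroup.mk0_eq_one_iff (pow_mem hv h)]
    have h2 : (⟨v.asIdeal ^ h, pow_mem hv h⟩ : nonZeroDivisors (Ideal (𝓞 F))) =
      ⟨v.asIdeal, hv⟩ ^ h := rfl
    rw [h2, map_pow, pow_card_eq_one]
  obtain ⟨a, ha⟩ := h1
  have ha' : v.asIdeal ^ h = Ideal.span {a} := ha
  have ha0 : a ≠ 0 := by
    rintro rfl
    rw [Ideal.span_singleton_eq_bot.2 rfl] at ha'
    exact pow_ne_zero h v.ne_bot ha'
  refine ⟨a, by simpa using ha0, ?_, fun w hw ↦ ?_⟩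
  · rw [HeightOneSpectrum.valuation_of_algebraMap]
    apply le_antisymm
    · rw [v.intValuation_le_pow_iff_mem, ha']
      exact Ideal.mem_span_singleton_self a
    · by_contra hlt
      rw [not_le] at hlt
      have h3 : v.intValuation a ≤ WithZero.exp (-((h + 1 : ℕ) : ℤ)) := by
        rw [← WithZero.exp_log (v.intValuation_ne_zero a ha0), WithZero.exp_lt_exp] at hlt
        rw [← WithZero.exp_log (v.intValuation_ne_zero a ha0), WithZero.exp_le_exp]
        push_cast
        omega
      rw [v.intValuation_le_pow_iff_mem] at h3
      have h4 : v.asIdeal ^ h ≤ v.asIdeal ^ (h + 1) := by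
        rw [ha', Ideal.span_singleton_le_iff_mem]
        exact h3
      have h5 := Ideal.pow_succ_lt_pow v.ne_bot h
      exact absurd h4 (not_le_of_gt h5)
  · rw [HeightOneSpectrum.valuation_eq_one_iff_notMem]
    intro haw
    apply hw
    have h6 : v.asIdeal ^ h ≤ w.asIdeal := by
      rw [ha', Ideal.span_singleton_le_iff_mem]
      exact haw
    exact HeightOneSpectrum.ext
      (v.isMaximal.eq_of_le w.isPrime.ne_top (w.isPrime.le_of_pow_le h6)).symm

/-- Some power of every idele is, up to a principal idele, a unit at all finite places; the
exponent is the class number. -/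
theorem exists_valued_pow_card_classGroup_eq (x : Ideles F) :
    ∃ a : Fˣ, ∀ v, Valued.v ((x ^ Fintype.card (ClassGroup (𝓞 F)) / principalIdele F a).val.2 v)
      = 1 := by
  classical
  set h := Fintype.card (ClassGroup (𝓞 F))
  choose a ha0 ha1 ha2 using exists_valuation_eq_exp_card_classGroup (F := F)
  have hfin : {v | ¬ Valued.v (x.val.2 v) = 1}.Finite := eventually_valued_component x
  let b : F := ∏ v ∈ hfin.toFinset, a v ^ (-WithZero.log (Valued.v (x.val.2 v)))
  have hb0 : b ≠ 0 := Finset.prod_ne_zero_iff.2 fun v _ ↦ zpow_ne_zero _ (ha0 v)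
  have hb (w : HeightOneSpectrum (𝓞 F)) : w.valuation F b = Valued.v (x.val.2 w) ^ h := by
    have hx0 : Valued.v (x.val.2 w) ≠ 0 := (Valuation.ne_zero_iff _).2 (component_ne_zero x w)
    have h1 : w.valuation F b =
        (w.valuation F (a w)) ^ (-WithZero.log (Valued.v (x.val.2 w))) := by
      rw [map_prod, Finset.prod_eq_single w]
      · rw [map_zpow₀]
      · intro v _ hvw
        rw [map_zpow₀, ha2 v w hvw.symm, one_zpow]
      · intro hw
        have hw' : Valued.v (x.val.2 w) = 1 := by simpa using hw
        rw [map_zpow₀, hw', WithZero.log_one, neg_zero, zpow_zero]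
    rw [h1, ha1, ← WithZero.exp_zsmul]
    conv_rhs => rw [← WithZero.exp_log hx0, ← WithZero.exp_nsmul]
    congr 1
    simp only [smul_eq_mul, nsmul_eq_mul]
    ring
  refine ⟨Units.mk0 b hb0, fun v ↦ ?_⟩
  have hp : (principalIdele F (Units.mk0 b hb0)).val.2 v = algebraMap F (v.adicCompletion F) b :=
    rfl
  have hx : (x ^ h).val.2 v = x.val.2 v ^ h := rfl
  rw [component_div, map_div₀, hx, hp, map_pow, valued_algebraMap, hb, div_self]
  exact pow_ne_zero _ ((Valuation.ne_zero_iff _).2 (component_ne_zero x v))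

/-- The unit ideles have finite exponent modulo `N`, since the quotient of the ring of integers
by `N` is finite. -/
theorem exists_pow_mem_congruenceSubgroup {N : ℕ} (hN : N ≠ 0) : ∃ n : ℕ, 0 < n ∧
    ∀ u : Ideles F, (∀ v, Valued.v (u.val.2 v) = 1) → u ^ n ∈ congruenceSubgroup F N Set.univ := by
  let I : Ideal (𝓞 F) := Ideal.span {(N : 𝓞 F)}
  have hI : I ≠ ⊥ := by
    rw [Ne, Ideal.span_singleton_eq_bot, Nat.cast_eq_zero]
    exact hN
  have : Finite (𝓞 F ⧸ I) := Ideal.finiteQuotientOfFreeOfNeBot I hI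
  refine ⟨Nat.card (𝓞 F ⧸ I)ˣ, Nat.card_pos, fun u hu v ↦ ?_⟩
  set n := Nat.card (𝓞 F ⧸ I)ˣ
  have hu' (v : HeightOneSpectrum (𝓞 F)) : Valued.v ((u⁻¹).val.2 v) = 1 := by
    rw [component_inv, map_inv₀, hu v, inv_one]
  obtain ⟨r, hr⟩ := exists_forall_valued_sub_le_of_integral u.val.2 (fun v ↦ (hu v).le) hN
  obtain ⟨s, hs⟩ := exists_forall_valued_sub_le_of_integral (u⁻¹).val.2 (fun v ↦ (hu' v).le) hN
  have hmem (t : 𝓞 F) : t ∈ I ↔ ∀ v : HeightOneSpectrum (𝓞 F),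
      Valued.v (algebraMap F (v.adicCompletion F) t) ≤ Valued.v (N : v.adicCompletion F) := by
    constructor
    · intro ht v
      obtain ⟨k, rfl⟩ := Ideal.mem_span_singleton.1 ht
      have hNk : (((N : 𝓞 F) * k : 𝓞 F) : F) = N * k := by
        change algebraMap (𝓞 F) F (N * k) = _
        rw [map_mul, map_natCast]
      rw [hNk, map_mul, map_mul, map_natCast]
      refine mul_le_of_le_one_right' ?_
      rw [valued_algebraMap]
      exact v.valuation_le_one k
    · intro ht
      have hN' : (N : F) ≠ 0 := Nat.cast_ne_zero.2 hN
      obtain ⟨k, hk⟩ := HeightOneSpectrum.mem_integers_of_valuation_le_one F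
        ((t : F) / N) fun v ↦ by
          have h := ht v
          rw [← map_natCast (algebraMap F (v.adicCompletion F)), valued_algebraMap,
            valued_algebraMap] at h
          rw [map_div₀]
          exact div_le_one_of_le₀ h zero_le
      refine Ideal.mem_span_singleton.2 ⟨k, ?_⟩
      apply RingOfIntegers.coe_injective
      rw [map_mul, map_natCast, hk, mul_div_cancel₀ _ hN']
  -- `s` approximates `u⁻¹`, so that `r` is invertible modulo `N`
  have hrs : r * s - 1 ∈ I := by
    rw [hmem]
    intro v
    have hmul : u.val.2 v * (u⁻¹).val.2 v = 1 := by
      rw [component_inv, mul_inv_cancel₀ (component_ne_zero u v)]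
    have h1 : algebraMap F (v.adicCompletion F) (algebraMap (𝓞 F) F (r * s - 1)) =
        -(algebraMap F (v.adicCompletion F) r * ((u⁻¹).val.2 v - algebraMap F _ (s : F))) -
          (u⁻¹).val.2 v * (u.val.2 v - algebraMap F _ (r : F)) := by
      rw [map_sub, map_sub, map_mul, map_mul, map_one, map_one]
      linear_combination hmul
    rw [h1]
    refine Valuation.map_sub_le _ ?_ ?_
    · rw [Valuation.map_neg, map_mul, valued_algebraMap]
      exact (mul_le_mul' (v.valuation_le_one r) (hs v)).trans (one_mul _).le
    · rw [map_mul, hu', one_mul]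
      exact hr v
  have hunit : IsUnit (Ideal.Quotient.mk I r) := by
    refine IsUnit.of_mul_eq_one (Ideal.Quotient.mk I s) ?_
    rw [← map_mul, ← map_one (Ideal.Quotient.mk I)]
    exact Ideal.Quotient.eq.2 hrs
  have hrn : r ^ n - 1 ∈ I := by
    rw [← Ideal.Quotient.eq, map_pow, map_one]
    obtain ⟨w, hw⟩ := hunit
    rw [← hw, ← Units.val_pow_eq_pow_val, pow_card_eq_one', Units.val_one]
  have hpow : (u ^ n).val.2 v = u.val.2 v ^ n := rfl
  rw [hpow]
  refine ⟨by rw [map_pow, hu, one_pow], fun _ ↦ ?_⟩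
  have hdiff (k : ℕ) : Valued.v (u.val.2 v ^ k - algebraMap F (v.adicCompletion F) r ^ k) ≤
      Valued.v (N : v.adicCompletion F) := by
    induction k with
    | zero =>
      rw [pow_zero, pow_zero, sub_self, map_zero]
      exact zero_le
    | succ k ih =>
      have h2 : u.val.2 v ^ (k + 1) - algebraMap F (v.adicCompletion F) r ^ (k + 1) =
          u.val.2 v * (u.val.2 v ^ k - algebraMap F (v.adicCompletion F) r ^ k) +
            algebraMap F (v.adicCompletion F) r ^ k *
              (u.val.2 v - algebraMap F (v.adicCompletion F) r) := by ring
      rw [h2]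
      refine Valuation.map_add_le _ ?_ ?_
      · rw [map_mul, hu, one_mul]
        exact ih
      · rw [map_mul, map_pow, valued_algebraMap]
        exact (mul_le_mul' (pow_le_one' (v.valuation_le_one r) k) (hr v)).trans (one_mul _).le
  have h3 : u.val.2 v ^ n - 1 = (u.val.2 v ^ n - algebraMap F (v.adicCompletion F) r ^ n) +
      algebraMap F (v.adicCompletion F) (algebraMap (𝓞 F) F (r ^ n - 1)) := by
    rw [map_sub, map_sub, map_pow, map_pow, map_one, map_one]
    ring
  rw [h3]
  exact Valuation.map_add_le _ (hdiff n) ((hmem _).1 hrn v)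

/-- The ray class groups have finite exponent. -/
theorem exists_pow_div_mem_congruenceSubgroup {N : ℕ} (hN : N ≠ 0) : ∃ e : ℕ, 0 < e ∧
    ∀ x : Ideles F, ∃ a : Fˣ, x ^ e / principalIdele F a ∈ congruenceSubgroup F N Set.univ := by
  obtain ⟨n, hn, h⟩ := exists_pow_mem_congruenceSubgroup (F := F) hN
  refine ⟨Fintype.card (ClassGroup (𝓞 F)) * n, mul_pos Fintype.card_pos hn, fun x ↦ ?_⟩
  obtain ⟨a, ha⟩ := exists_valued_pow_card_classGroup_eq x
  refine ⟨a ^ n, ?_⟩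
  rw [map_pow, pow_mul, ← div_pow]
  exact h _ ha

end Approximation

/-! ### Complex conjugation on ideles -/

section Conjugation

variable {F : Type*} [Field F] [NumberField F] [Algebra.IsQuadraticExtension ℚ F]
  [IsTotallyComplex F]

theorem conjugation_conjugation (x : F) : conjugation F (conjugation F x) = x :=
  haveI : IsCMField F := IsCMField.ofCMExtension ℚ F
  IsCMField.complexConj_apply_apply F x

theorem embedding_conjugation (ι : F →+* ℂ) (x : F) :
    ι (conjugation F x) = starRingEnd ℂ (ι x) :=
  haveI : IsCMField F := IsCMField.ofCMExtension ℚ F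
  IsCMField.complexEmbedding_complexConj F ι x

theorem exists_ratCast_eq_of_conjugation_eq {x : F} (hx : conjugation F x = x) :
    ∃ q : ℚ, (q : F) = x := by
  have : IsCMField F := IsCMField.ofCMExtension ℚ F
  have hx' : x ∈ maximalRealSubfield F := (IsCMField.complexConj_eq_self_iff F x).1 hx
  refine ⟨(CMExtension.equivMaximalRealSubfield ℚ F).symm ⟨x, hx'⟩, ?_⟩
  have h := CMExtension.algebraMap_equivMaximalRealSubfield_symm_apply ℚ F ⟨x, hx'⟩
  rw [eq_ratCast] at h
  exact h

theorem exists_conjugation_ne : ∃ x : F, conjugation F x ≠ x := by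
  have : IsCMField F := IsCMField.ofCMExtension ℚ F
  by_contra! h
  exact IsCMField.complexConj_ne_one F (AlgEquiv.ext h)

theorem exists_intCast_eq_of_forall_valuation_le_one {q : ℚ}
    (h : ∀ v : HeightOneSpectrum (𝓞 F), v.valuation F (q : F) ≤ 1) : ∃ n : ℤ, (n : ℚ) = q := by
  obtain ⟨r, hr⟩ := HeightOneSpectrum.mem_integers_of_valuation_le_one F (q : F) h
  have h1 : IsIntegral ℤ (algebraMap ℚ F q) := by
    rw [eq_ratCast, ← hr]
    exact r.isIntegral_coe
  rw [isIntegral_algebraMap_iff (algebraMap ℚ F).injective] at h1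
  obtain ⟨n, hn⟩ := IsIntegrallyClosed.isIntegral_iff.1 h1
  exact ⟨n, by simpa using hn⟩

/-- An imaginary quadratic field is generated by an integral square root of a negative integer. -/
theorem exists_sq_eq_neg_natCast : ∃ (δ : 𝓞 F) (D : ℕ), D ≠ 0 ∧ δ ^ 2 = -(D : 𝓞 F) ∧
    conjugation F δ = -(δ : F) := by
  obtain ⟨x, hx⟩ := exists_conjugation_ne (F := F)
  obtain ⟨⟨y, m, hm⟩, hy⟩ := IsLocalization.surj (Algebra.algebraMapSubmonoid (𝓞 F)
    (nonZeroDivisors ℤ)) (x - conjugation F x)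
  obtain ⟨k, hk, rfl⟩ := hm
  have hk0 : (k : F) ≠ 0 := Int.cast_ne_zero.2 (nonZeroDivisors.ne_zero hk)
  have hy' : (y : F) = (x - conjugation F x) * k := by
    rw [eq_comm] at hy
    simpa using hy
  have hconj : conjugation F y = -(y : F) := by
    rw [hy', map_mul, map_sub, conjugation_conjugation, map_intCast]
    ring
  have hy0 : (y : F) ≠ 0 := by
    rw [hy']
    exact mul_ne_zero (sub_ne_zero.2 hx.symm) hk0
  obtain ⟨q, hq⟩ := exists_ratCast_eq_of_conjugation_eq (x := (y : F) ^ 2) (by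
    rw [map_pow, hconj, neg_sq])
  obtain ⟨n, hn⟩ := exists_intCast_eq_of_forall_valuation_le_one (F := F) (q := q) fun v ↦ by
    rw [hq, map_pow]
    exact pow_le_one' (v.valuation_le_one y) 2
  have hn' : (y : F) ^ 2 = n := by
    rw [← hq, ← hn, Rat.cast_intCast]
  have hneg : n < 0 := by
    let ι : F →+* ℂ := Classical.choice inferInstance
    have h1 : starRingEnd ℂ (ι y) = -ι y := by rw [← embedding_conjugation, hconj, map_neg]
    have h2 : ι y ^ 2 = n := by rw [← map_pow, hn', map_intCast]
    have hre : (ι y).re = 0 := by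
      have := congrArg Complex.re h1
      rw [Complex.conj_re, Complex.neg_re] at this
      linarith
    have him : (ι y).im ≠ 0 := by
      intro h
      have : ι y = 0 := Complex.ext hre h
      exact hy0 ((map_eq_zero ι).1 this)
    have h3 := congrArg Complex.re h2
    rw [sq, Complex.mul_re, hre, Complex.intCast_re] at h3
    have h4 : (n : ℝ) < 0 := by
      rw [← h3]
      have := mul_self_pos.2 him
      linarith
    exact_mod_cast h4
  refine ⟨y, n.natAbs, by omega, ?_, hconj⟩
  apply RingOfIntegers.coe_injective
  have h5 : (n : F) = -((n.natAbs : ℤ) : F) := by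
    rw [← Int.cast_neg]
    congr 1
    omega
  rw [map_pow, map_neg, map_natCast, hn', h5, Int.cast_natCast]

/-- An element with norm a unit has norm `1`, as norms from an imaginary quadratic field are
positive. -/
theorem mul_conjugation_eq_one {a : F} (ha : a ≠ 0)
    (h : ∀ v : HeightOneSpectrum (𝓞 F), v.valuation F (a * conjugation F a) = 1) :
    a * conjugation F a = 1 := by
  obtain ⟨q, hq⟩ := exists_ratCast_eq_of_conjugation_eq (x := a * conjugation F a) (by
    rw [map_mul, conjugation_conjugation, mul_comm])
  obtain ⟨n, hn⟩ := exists_intCast_eq_of_forall_valuation_le_one (F := F) (q := q) fun v ↦ by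
    rw [hq]
    exact (h v).le
  obtain ⟨m, hm⟩ := exists_intCast_eq_of_forall_valuation_le_one (F := F) (q := q⁻¹) fun v ↦ by
    rw [Rat.cast_inv, hq, map_inv₀, h v, inv_one]
  have hpos : 0 < n := by
    let ι : F →+* ℂ := Classical.choice inferInstance
    have h1 : (ι a) * starRingEnd ℂ (ι a) = n := by
      rw [← embedding_conjugation, ← map_mul, ← hq, ← hn, Rat.cast_intCast, map_intCast]
    rw [Complex.mul_conj] at h1
    have h2 : Complex.normSq (ι a) = (n : ℝ) := by exact_mod_cast h1
    have h3 : (0 : ℝ) < n := by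
      rw [← h2, Complex.normSq_pos]
      simpa using ha
    exact_mod_cast h3
  have hq0 : q ≠ 0 := by
    rw [← hn]
    exact_mod_cast hpos.ne'
  have hnm : n * m = 1 := by
    have : (n : ℚ) * m = 1 := by rw [hn, hm, mul_inv_cancel₀ hq0]
    exact_mod_cast this
  have hn1 : n = 1 := by
    rcases Int.mul_eq_one_iff_eq_one_or_neg_one.1 hnm with h | h <;> omega
  rw [← hq, ← hn, hn1]
  norm_num

/-- Hilbert's Theorem 90 for an imaginary quadratic field. -/
theorem exists_eq_conjugation_div {a : F} (h : a * conjugation F a = 1) :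
    ∃ b : F, b ≠ 0 ∧ a = conjugation F b / b := by
  -- `b = 1 + conj a` works unless it vanishes
  by_cases h1 : 1 + conjugation F a = 0
  · obtain ⟨x, hx⟩ := exists_conjugation_ne (F := F)
    have hb : x - conjugation F x ≠ 0 := sub_ne_zero.2 hx.symm
    refine ⟨x - conjugation F x, hb, ?_⟩
    have ha : a = -1 := by
      have h2 := congrArg (conjugation F) h1
      rw [map_add, map_one, conjugation_conjugation, map_zero] at h2
      linear_combination h2
    rw [eq_div_iff hb, ha, map_sub, conjugation_conjugation]
    ring
  · refine ⟨1 + conjugation F a, h1, ?_⟩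
    rw [eq_div_iff h1, map_add, map_one, conjugation_conjugation, mul_add, h]
    ring

theorem pullPlace_pullPlace (v : HeightOneSpectrum (𝓞 F)) :
    pullPlace (conjugation F) (pullPlace (conjugation F) v) = v := by
  apply HeightOneSpectrum.ext
  ext r
  have h1 := mem_pullPlace_pow (conjugation F) (pullPlace (conjugation F) v) 1 r
  have h2 := mem_pullPlace_pow (conjugation F) v 1 (RingOfIntegers.mapRingEquiv (conjugation F) r)
  rw [pow_one, pow_one] at h1 h2
  rw [h1, h2]
  have h3 : RingOfIntegers.mapRingEquiv (conjugation F)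
      (RingOfIntegers.mapRingEquiv (conjugation F) r) = r :=
    RingOfIntegers.coe_injective (conjugation_conjugation (r : F))
  rw [h3]

theorem continuous_ringHom_apply_eq (x : FiniteAdeleRing (𝓞 F) F)
    {v w : HeightOneSpectrum (𝓞 F)} (h : w = v)
    (g : w.adicCompletion F →+* v.adicCompletion F) (hg : Continuous g)
    (hg' : ∀ k : F, g (algebraMap F (w.adicCompletion F) k) =
      algebraMap F (v.adicCompletion F) k) : g (x w) = x v := by
  subst h
  exact congrFun ((HeightOneSpectrum.denseRange_algebraMap F w).equalizer hg continuous_id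
    (funext hg')) (x w)

theorem denseRange_infinitePlace_coe (w : InfinitePlace F) :
    DenseRange fun k : F ↦ (k : w.Completion) := by
  have h := InfinitePlace.Completion.denseRange_coe w
  rwa [DenseRange, ← (WithAbs.equiv w.1).symm.surjective.range_comp] at h

theorem continuous_ringHom_apply_eq_infinite (x : InfiniteAdeleRing F)
    {v w : InfinitePlace F} (h : w = v)
    (g : w.Completion →+* v.Completion) (hg : Continuous g)
    (hg' : ∀ k : F, g (k : w.Completion) = (k : v.Completion)) : g (x w) = x v := by
  subst h
  exact congrFun ((denseRange_infinitePlace_coe w).equalizer hg continuous_id (funext hg')) (x w)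

theorem infinitePlace_comap_conjugation (v : InfinitePlace F) :
    v.comap (conjugation F : F →+* F) = v := by
  have : IsCMField F := IsCMField.ofCMExtension ℚ F
  refine InfinitePlace.ext _ _ fun x ↦ ?_
  exact IsCMField.infinitePlace_complexConj F v x

theorem adeleMap_conjugation_involutive (x : AdeleRing (𝓞 F) F) :
    adeleMap (conjugation F) (adeleMap (conjugation F) x) = x := by
  refine Prod.ext (funext fun v ↦ ?_) (FiniteAdeleRing.ext F fun v ↦ ?_)
  · refine continuous_ringHom_apply_eq_infinite x.1
      (w := (v.comap (conjugation F : F →+* F)).comap (conjugation F : F →+* F))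
      (by rw [infinitePlace_comap_conjugation, infinitePlace_comap_conjugation])
      ((infiniteLocalMap (conjugation F) v).comp
        (infiniteLocalMap (conjugation F) (v.comap (conjugation F : F →+* F))))
      ((continuous_infiniteLocalMap (conjugation F) v).comp
        (continuous_infiniteLocalMap (conjugation F) (v.comap (conjugation F : F →+* F))))
      fun k ↦ ?_
    rw [RingHom.comp_apply, infiniteLocalMap_coe, infiniteLocalMap_coe, conjugation_conjugation]
  · refine continuous_ringHom_apply_eq x.2 (pullPlace_pullPlace v)
      ((localMap (conjugation F) v).comp
        (localMap (conjugation F) (pullPlace (conjugation F) v)))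
      ((continuous_localMap (conjugation F) v).comp
        (continuous_localMap (conjugation F) (pullPlace (conjugation F) v))) fun k ↦ ?_
    have h1 := localMap_coe (conjugation F) (pullPlace (conjugation F) v) k
    have h2 := localMap_coe (conjugation F) v (conjugation F k)
    rw [conjugation_conjugation] at h2
    exact (congrArg _ h1).trans h2

variable (F) in
/-- Complex conjugation on the ideles. -/
def conjIdele : Ideles F →* Ideles F :=
  Units.map (adeleMap (conjugation F) : AdeleRing (𝓞 F) F →* AdeleRing (𝓞 F) F)

theorem HeckeCharacter.conj_apply (χ : HeckeCharacter F) (x : Ideles F) :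
    χ.conj.1 x = χ.1 (conjIdele F x) := rfl

theorem conjIdele_conjIdele (x : Ideles F) : conjIdele F (conjIdele F x) = x :=
  Units.ext (adeleMap_conjugation_involutive x.val)

theorem conjIdele_snd (x : Ideles F) (v : HeightOneSpectrum (𝓞 F)) :
    (conjIdele F x).val.2 v =
      localMap (conjugation F) v (x.val.2 (pullPlace (conjugation F) v)) := rfl

theorem valued_conjIdele (x : Ideles F) (v : HeightOneSpectrum (𝓞 F)) :
    Valued.v ((conjIdele F x).val.2 v) = Valued.v (x.val.2 (pullPlace (conjugation F) v)) :=
  valued_localMap _ _ _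

theorem conjIdele_principalIdele (a : Fˣ) : conjIdele F (principalIdele F a) =
    principalIdele F (Units.map (conjugation F : F →* F) a) :=
  Units.ext (adeleMap_algebraMap (conjugation F) a)

theorem conjIdele_fst {x : Ideles F} (hx : x.val.1 = 1) : (conjIdele F x).val.1 = 1 := by
  change infiniteAdeleMap (conjugation F) x.val.1 = 1
  rw [hx, map_one]

theorem conjIdele_snd_eq_one {x : Ideles F} (hx : x.val.2 = 1) :
    (conjIdele F x).val.2 = 1 := by
  change finiteAdeleMap (conjugation F) x.val.2 = 1
  rw [hx, map_one]

theorem conjIdele_mem_congruenceSubgroup {N : ℕ} {S : Set (HeightOneSpectrum (𝓞 F))}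
    (hS : ∀ v ∈ S, pullPlace (conjugation F) v ∈ S) {x : Ideles F}
    (hx : x ∈ congruenceSubgroup F N S) : conjIdele F x ∈ congruenceSubgroup F N S := by
  intro v
  refine ⟨by rw [valued_conjIdele, (hx _).1], fun hv ↦ ?_⟩
  have h := (hx _).2 (hS v hv)
  rw [← valued_localMap (conjugation F) v, ← valued_localMap (conjugation F) v, map_sub, map_one,
    map_natCast] at h
  exact h

end Conjugation

/-! ### Prime numbers represented up to sign by a residue class that split -/

section Reciprocity

/-- The quadratic character attached to a negative discriminant is odd: its value at
`4 * D - 1`, which is `-1` modulo `4 * D`, is `-1`. -/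
theorem jacobiSym_four_mul_sub_one {D : ℕ} (hD : D ≠ 0) :
    jacobiSym (-(D : ℤ)) (4 * D - 1) = -1 := by
  have hodd : Odd (4 * D - 1) := ⟨2 * D - 1, by omega⟩
  have h1 : jacobiSym (4 * (D : ℤ)) (4 * D - 1) = 1 := by
    have h2 : (4 * (D : ℤ)) % ((4 * D - 1 : ℕ) : ℤ) = 1 % ((4 * D - 1 : ℕ) : ℤ) := by
      have h3 : 4 * (D : ℤ) = 1 + ((4 * D - 1 : ℕ) : ℤ) := by omega
      rw [h3, Int.add_emod_right]
    rw [jacobiSym.mod_left, h2, ← jacobiSym.mod_left, jacobiSym.one_left]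
  rw [jacobiSym.mul_left, jacobiSym.at_four hodd, one_mul] at h1
  rw [jacobiSym.neg _ hodd, h1, ZMod.χ₄_nat_three_mod_four (by omega), mul_one]

/-- By Dirichlet's theorem and quadratic reciprocity, every residue class is represented up to sign
by a prime modulo which a given negative integer is a square. -/
theorem exists_prime_isSquare {D M : ℕ} (hD : D ≠ 0) (hM : M ≠ 0) (hDM : 4 * D ∣ M) {s : ℤ}
    (hs : IsCoprime s M) : ∃ (q : ℕ) (ε : ℤ), q.Prime ∧ (ε = 1 ∨ ε = -1) ∧
      (M : ℤ) ∣ q - ε * s ∧ IsSquare ((-(D : ℤ) : ℤ) : ZMod q) := by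
  -- primes `q` and `r` in opposite classes have different symbols, as `-D` is an odd character
  obtain ⟨q, hqM, hq, hqs⟩ := Nat.forall_exists_prime_gt_and_zmodEq M hM hs
  obtain ⟨r, hrM, hr, hrs⟩ := Nat.forall_exists_prime_gt_and_zmodEq M hM hs.neg_left
  have h4 : 4 ≤ M := (Nat.le_mul_of_pos_right 4 (Nat.pos_of_ne_zero hD)).trans
    (Nat.le_of_dvd (Nat.pos_of_ne_zero hM) hDM)
  have hqodd : Odd q := hq.odd_of_ne_two (by omega)
  have hrodd : Odd r := hr.odd_of_ne_two (by omega)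
  have : Fact q.Prime := ⟨hq⟩
  have : Fact r.Prime := ⟨hr⟩
  by_cases hJ : jacobiSym (-(D : ℤ)) q = 1
  · exact ⟨q, 1, hq, .inl rfl, by rw [one_mul]; exact hqs.symm.dvd,
      ZMod.isSquare_of_jacobiSym_eq_one hJ⟩
  · refine ⟨r, -1, hr, .inr rfl, by rw [neg_one_mul]; exact hrs.symm.dvd, ?_⟩
    apply ZMod.isSquare_of_jacobiSym_eq_one
    have hcop : Int.gcd (-(D : ℤ)) q = 1 := by
      rw [Int.neg_gcd, Int.gcd_natCast_natCast]
      refine Nat.Coprime.symm ((Nat.Prime.coprime_iff_not_dvd hq).2 fun h ↦ ?_)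
      have h1 := Nat.le_of_dvd (Nat.pos_of_ne_zero hM) (((h.mul_left 4)).trans hDM)
      omega
    have hJ' : jacobiSym (-(D : ℤ)) q = -1 := (jacobiSym.eq_one_or_neg_one hcop).resolve_left hJ
    have hmod : r % (4 * D) = q * (4 * D - 1) % (4 * D) := by
      have h1 : ((4 * D : ℕ) : ℤ) ∣ r + q := by
        have h2 : (M : ℤ) ∣ r + q := by
          have := dvd_sub hqs.symm.dvd (dvd_neg.2 hrs.symm.dvd)
          convert! this using 1
          ring
        exact (Int.natCast_dvd_natCast.2 hDM).trans h2
      have h3 : (r : ℤ) ≡ ((q * (4 * D - 1) : ℕ) : ℤ) [ZMOD ((4 * D : ℕ) : ℤ)] := by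
        rw [Int.modEq_iff_dvd]
        have h5 : ((q * (4 * D - 1) : ℕ) : ℤ) - r = ((4 * D : ℕ) : ℤ) * q - (r + q) := by
          rw [Nat.cast_mul, Nat.cast_sub (by omega)]
          push_cast
          ring
        rw [h5]
        exact dvd_sub (dvd_mul_right _ _) h1
      exact Int.natCast_modEq_iff.1 h3
    have hodd : Odd (4 * D - 1) := ⟨2 * D - 1, by omega⟩
    have hne : NeZero q := ⟨hq.ne_zero⟩
    have hne' : NeZero (4 * D - 1) := ⟨by omega⟩
    have h6 := jacobiSym.mod_right (-(D : ℤ)) hrodd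
    have h7 := jacobiSym.mod_right (-(D : ℤ)) (hqodd.mul hodd)
    rw [Int.natAbs_neg, Int.natAbs_natCast] at h6 h7
    rw [h6, hmod, ← h7, jacobiSym.mul_right, hJ', jacobiSym_four_mul_sub_one hD]
    norm_num

end Reciprocity

/-! ### Characters on conjugation-invariant ideles -/

section Invariant

variable {F : Type*} [Field F] [NumberField F] [Algebra.IsQuadraticExtension ℚ F]
  [IsTotallyComplex F]

theorem valued_natCast_pullPlace (v : HeightOneSpectrum (𝓞 F)) (n : ℕ) :
    Valued.v (n : (pullPlace (conjugation F) v).adicCompletion F) =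
      Valued.v (n : v.adicCompletion F) := by
  rw [← valued_localMap (conjugation F) v, map_natCast]

theorem natCast_mem_iff_valued_ne_one (v : HeightOneSpectrum (𝓞 F)) (n : ℕ) :
    (n : 𝓞 F) ∈ v.asIdeal ↔ Valued.v (n : v.adicCompletion F) ≠ 1 := by
  rw [valued_natCast, Ne, HeightOneSpectrum.intValuation_eq_one_iff, not_not]

theorem valued_intCast_eq_one_of_isCoprime {v : HeightOneSpectrum (𝓞 F)} {s : ℤ} {M : ℕ}
    (h : IsCoprime s M) (hM : Valued.v (M : v.adicCompletion F) ≠ 1) :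
    Valued.v (s : v.adicCompletion F) = 1 := by
  rw [← map_intCast (algebraMap F (v.adicCompletion F)), valued_algebraMap,
    ← map_intCast (algebraMap (𝓞 F) F), HeightOneSpectrum.valuation_of_algebraMap,
    HeightOneSpectrum.intValuation_eq_one_iff]
  intro hs
  rw [← natCast_mem_iff_valued_ne_one] at hM
  obtain ⟨a, b, hab⟩ := h
  have h1 : (a : 𝓞 F) * (s : 𝓞 F) + (b : 𝓞 F) * (M : 𝓞 F) = 1 := by exact_mod_cast hab
  refine v.isPrime.ne_top ((Ideal.eq_top_iff_one _).2 ?_)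
  rw [← h1]
  exact add_mem (Ideal.mul_mem_left _ _ hs) (Ideal.mul_mem_left _ _ hM)

/-- An integer is the product of a divisor of a power of `M` and an integer prime to `M`. -/
theorem exists_eq_mul_isCoprime {M : ℕ} {n : ℤ} (hn : n ≠ 0) :
    ∃ (m : ℕ) (s : ℤ) (j : ℕ), n = m * s ∧ m ∣ M ^ j ∧ IsCoprime s M := by
  induction h : n.natAbs using Nat.strong_induction_on generalizing n with
  | _ k ih =>
    by_cases hg : Int.gcd n M = 1
    · exact ⟨1, n, 0, by simp, by simp, Int.isCoprime_iff_gcd_eq_one.2 hg⟩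
    · obtain ⟨n', hn'⟩ := Int.gcd_dvd_left n (M : ℤ)
      set g := Int.gcd n M
      have hg0 : g ≠ 0 := fun h0 ↦ hn (by rw [hn', h0]; simp)
      have hn'0 : n' ≠ 0 := by
        rintro rfl
        exact hn (by rw [hn', mul_zero])
      have hlt : n'.natAbs < k := by
        rw [← h, hn', Int.natAbs_mul, Int.natAbs_natCast]
        exact lt_mul_of_one_lt_left (Int.natAbs_pos.2 hn'0) (by omega)
      obtain ⟨m, s, j, h1, h2, h3⟩ := ih _ hlt hn'0 rfl
      refine ⟨g * m, s, j + 1, ?_, ?_, h3⟩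
      · rw [Nat.cast_mul, mul_assoc, ← h1]
        exact hn'
      · rw [pow_succ']
        exact mul_dvd_mul (Int.natCast_dvd_natCast.1 (Int.gcd_dvd_right n (M : ℤ))) h2

/-- If `-D = δ ^ 2` is a square modulo `q`, and `q` is prime to `4 * D`, then the prime divisors of
`q` split in `F`. Up to units, `q` is then the norm of the idele that is `q` at one of each pair of
conjugate places dividing `q` and `1` elsewhere. -/
theorem exists_valued_mul_conjIdele_eq {δ : 𝓞 F} {D M q : ℕ} (hδ : δ ^ 2 = -(D : 𝓞 F))
    (hδ' : conjugation F δ = -(δ : F)) (hDM : 4 * D ∣ M) (hq : q ≠ 0) (hqM : IsCoprime (q : ℤ) M)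
    (hsq : IsSquare ((-(D : ℤ) : ℤ) : ZMod q)) :
    ∃ z : Ideles F, (∀ v, Valued.v ((z * conjIdele F z).val.2 v) =
        Valued.v (q : v.adicCompletion F)) ∧
      ∀ v, Valued.v (M : v.adicCompletion F) ≠ 1 → (z * conjIdele F z).val.2 v = 1 := by
  classical
  obtain ⟨s, hs⟩ : ∃ s : ℤ, (q : ℤ) ∣ -(D : ℤ) - s * s := by
    obtain ⟨t, ht⟩ := hsq
    obtain ⟨s, rfl⟩ := ZMod.intCast_surjective t
    refine ⟨s, ?_⟩
    rw [← Int.cast_mul, ZMod.intCast_eq_intCast_iff] at ht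
    exact ht.symm.dvd
  -- of the two places above a prime divisor of `q`, `P` selects the one dividing `δ - s`
  let P (v : HeightOneSpectrum (𝓞 F)) : Prop := (q : 𝓞 F) ∈ v.asIdeal ∧ δ - s ∈ v.asIdeal
  have hq' (v : HeightOneSpectrum (𝓞 F)) : (q : v.adicCompletion F) ≠ 0 := fun h ↦
    valued_natCast_ne_zero v hq (by rw [h, map_zero])
  let f (v : HeightOneSpectrum (𝓞 F)) : v.adicCompletion F := if P v then q else 1
  have hf0 (v) : f v ≠ 0 := by
    dsimp only [f]
    split_ifs
    exacts [hq' v, one_ne_zero]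
  have hf1 : ∀ᶠ v in Filter.cofinite, Valued.v (f v) = 1 := by
    refine (finite_valued_ne_one hq).subset fun v hv hv' ↦ hv ?_
    change Valued.v (if P v then (q : v.adicCompletion F) else 1) = 1
    split_ifs
    exacts [hv', map_one _]
  have hz (v : HeightOneSpectrum (𝓞 F)) :
      (finiteIdele f hf0 hf1 * conjIdele F (finiteIdele f hf0 hf1)).val.2 v =
        (if P v then (q : v.adicCompletion F) else 1) *
          (if P (pullPlace (conjugation F) v) then (q : v.adicCompletion F) else 1) := by
    have h1 : (finiteIdele f hf0 hf1 * conjIdele F (finiteIdele f hf0 hf1)).val.2 v =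
      f v * localMap (conjugation F) v (f (pullPlace (conjugation F) v)) := rfl
    rw [h1]
    congr 1
    dsimp only [f]
    split_ifs
    exacts [map_natCast _ _, map_one _]
  have hP (v : HeightOneSpectrum (𝓞 F)) : P (pullPlace (conjugation F) v) ↔
      (q : 𝓞 F) ∈ v.asIdeal ∧ δ + s ∈ v.asIdeal := by
    have h1 := mem_pullPlace_pow (conjugation F) v 1 (q : 𝓞 F)
    have h2 := mem_pullPlace_pow (conjugation F) v 1 (δ - s)
    have h3 : RingOfIntegers.mapRingEquiv (conjugation F) δ = -δ :=
      RingOfIntegers.coe_injective hδ'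
    rw [pow_one, pow_one, map_natCast] at h1
    rw [pow_one, pow_one, map_sub, map_intCast, h3, ← neg_add', neg_mem_iff] at h2
    exact and_congr h1 h2
  refine ⟨finiteIdele f hf0 hf1, fun v ↦ ?_, fun v hv ↦ ?_⟩
  · rw [hz]
    by_cases hqv : (q : 𝓞 F) ∈ v.asIdeal
    · have hor : δ - s ∈ v.asIdeal ∨ δ + s ∈ v.asIdeal := by
        apply v.isPrime.mem_or_mem
        obtain ⟨k, hk⟩ := hs
        have h4 : (δ - s) * (δ + s) = (q : 𝓞 F) * (k : 𝓞 F) := by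
          have h5 : (-(D : 𝓞 F) - ((s * s : ℤ) : 𝓞 F)) = ((q * k : ℤ) : 𝓞 F) := by
            rw [← hk]
            push_cast
            ring
          push_cast at h5
          rw [← h5, ← hδ]
          ring
        rw [h4]
        exact Ideal.mul_mem_right _ _ hqv
      have hnot : ¬ (δ - s ∈ v.asIdeal ∧ δ + s ∈ v.asIdeal) := by
        rintro ⟨h6, h7⟩
        have h8 : ((4 * D : ℕ) : 𝓞 F) ∈ v.asIdeal := by
          have h9 : ((4 * D : ℕ) : 𝓞 F) = -((δ - s) + (δ + s)) * ((δ - s) + (δ + s)) := by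
            have h10 : (D : 𝓞 F) = -δ ^ 2 := by rw [hδ, neg_neg]
            push_cast
            rw [h10]
            ring
          rw [h9]
          exact Ideal.mul_mem_left _ _ (add_mem h6 h7)
        have h11 : (M : 𝓞 F) ∈ v.asIdeal := by
          obtain ⟨k, rfl⟩ := hDM
          rw [Nat.cast_mul]
          exact Ideal.mul_mem_right _ _ h8
        rw [natCast_mem_iff_valued_ne_one] at h11 hqv
        have h12 := valued_intCast_eq_one_of_isCoprime hqM h11
        exact hqv (by exact_mod_cast h12)
      simp only [hP]
      by_cases h13 : δ - s ∈ v.asIdeal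
      · have h14 : δ + s ∉ v.asIdeal := fun h ↦ hnot ⟨h13, h⟩
        simp [P, hqv, h13, h14]
      · have h14 : δ + s ∈ v.asIdeal := hor.resolve_left h13
        simp [P, hqv, h13, h14]
    · have h15 : Valued.v (q : v.adicCompletion F) = 1 := by
        by_contra h
        exact hqv ((natCast_mem_iff_valued_ne_one v q).2 h)
      simp only [hP]
      simp [P, hqv, h15]
  · have hqv : (q : 𝓞 F) ∉ v.asIdeal := by
      rw [natCast_mem_iff_valued_ne_one, not_not]
      exact_mod_cast valued_intCast_eq_one_of_isCoprime hqM hv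
    rw [hz]
    simp only [hP]
    simp [P, hqv]

/-- A conjugation-invariant idele is approximated by rational numbers. -/
theorem exists_rat_valued_sub_le {y : Ideles F} (hy : ∀ v, (conjIdele F y).val.2 v = y.val.2 v)
    {M : ℕ} (hM : M ≠ 0) : ∃ r : ℚ, ∀ v,
      Valued.v (y.val.2 v - algebraMap F (v.adicCompletion F) r) ≤
        Valued.v (M : v.adicCompletion F) := by
  obtain ⟨f, hf⟩ := exists_forall_valued_sub_le y.val.2 (mul_ne_zero two_ne_zero hM)
  obtain ⟨r, hr⟩ := exists_ratCast_eq_of_conjugation_eq (x := (f + conjugation F f) / 2) (by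
    rw [map_div₀, map_add, conjugation_conjugation, map_ofNat, add_comm])
  refine ⟨r, fun v ↦ ?_⟩
  have h1 : Valued.v (y.val.2 v - algebraMap F (v.adicCompletion F) (conjugation F f)) ≤
      Valued.v ((2 * M : ℕ) : v.adicCompletion F) := by
    have h2 := hf (pullPlace (conjugation F) v)
    rw [valued_natCast_pullPlace, ← valued_localMap (conjugation F) v, map_sub] at h2
    have h3 : localMap (conjugation F) v (algebraMap F _ f) =
        algebraMap F (v.adicCompletion F) (conjugation F f) := localMap_coe _ v f
    rw [h3] at h2
    rw [← hy]
    exact h2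
  have h3 : Valued.v ((2 : ℕ) : v.adicCompletion F) ≠ 0 := valued_natCast_ne_zero v two_ne_zero
  have h4 : ((2 : ℕ) : v.adicCompletion F) ≠ 0 := fun h ↦ h3 (by rw [h, map_zero])
  have h5 : ((2 : ℕ) : v.adicCompletion F) *
      (y.val.2 v - algebraMap F (v.adicCompletion F) r) =
      (y.val.2 v - algebraMap F (v.adicCompletion F) f) +
        (y.val.2 v - algebraMap F (v.adicCompletion F) (conjugation F f)) := by
    have h6 : algebraMap F (v.adicCompletion F) r * ((2 : ℕ) : v.adicCompletion F) =
        algebraMap F (v.adicCompletion F) f +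
          algebraMap F (v.adicCompletion F) (conjugation F f) := by
      rw [← map_add, ← map_natCast (algebraMap F (v.adicCompletion F)), ← map_mul, hr,
        Nat.cast_ofNat, div_mul_cancel₀ _ (two_ne_zero)]
    push_cast at h6 ⊢
    linear_combination -h6
  have h7 := Valuation.map_add_le _ (hf v) h1
  rw [← h5, map_mul, Nat.cast_mul, map_mul] at h7
  exact (mul_le_mul_iff_right₀ (zero_lt_iff.2 h3)).1 h7

/-- A character of the idele class group that is trivial at infinity and is inverted by complex
conjugation is trivial on conjugation-invariant ideles. It is a quadratic character there, trivial
on norms; being trivial at infinity, it cannot be the odd character attached to the field.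
Triviality at infinity is part of `hθ`, as congruence subgroups allow any infinite components. -/
theorem eq_one_of_conjIdele_eq {A : Type*} [CommGroup A] (θ : Ideles F →* A)
    (hF : ∀ a, θ (principalIdele F a) = 1) {N : ℕ} (hN : N ≠ 0)
    (hθ : ∀ x ∈ congruenceSubgroup F N Set.univ, θ x = 1)
    (hc : ∀ x, θ (conjIdele F x) = (θ x)⁻¹) {y : Ideles F}
    (hy : ∀ v, (conjIdele F y).val.2 v = y.val.2 v) : θ y = 1 := by
  obtain ⟨δ, D, hD, hδ, hδ'⟩ := exists_sq_eq_neg_natCast (F := F)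
  have hy0 (v) : Valued.v (y.val.2 v) ≠ 0 := (Valuation.ne_zero_iff _).2 (component_ne_zero y v)
  have hfin : {v | ¬ Valued.v (y.val.2 v) = 1}.Finite := eventually_valued_component y
  -- `K` bounds the numerators and denominators of `y`
  obtain ⟨K, hK, hKy⟩ := exists_natCast_valued_le_of_finite hfin
    (fun v ↦ min (Valued.v (y.val.2 v)) (Valued.v (y.val.2 v))⁻¹) fun v _ ↦ by
      rcases min_choice (Valued.v (y.val.2 v)) (Valued.v (y.val.2 v))⁻¹ with h | h <;> rw [h]
      exacts [hy0 v, inv_ne_zero (hy0 v)]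
  have hK1 (v) : Valued.v (K : v.adicCompletion F) ≤ Valued.v (y.val.2 v) := by
    by_cases hv : Valued.v (y.val.2 v) = 1
    · rw [hv]
      exact valued_natCast_le_one v K
    · exact (hKy v hv).trans (min_le_left _ _)
  have hK2 (v) : Valued.v (K : v.adicCompletion F) * Valued.v (y.val.2 v) ≤ 1 := by
    by_cases hv : Valued.v (y.val.2 v) = 1
    · rw [hv, mul_one]
      exact valued_natCast_le_one v K
    · exact (mul_le_mul_left ((hKy v hv).trans (min_le_right _ _)) _).trans inv_mul_le_one
  have hK3 (v) (hv : Valued.v (K : v.adicCompletion F) = 1) : Valued.v (y.val.2 v) = 1 :=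
    le_antisymm (by simpa [hv] using hK2 v) (hv ▸ hK1 v)
  let M := 4 * D * (N * K)
  have hM : M ≠ 0 := mul_ne_zero (mul_ne_zero (by norm_num) hD) (mul_ne_zero hN hK)
  have hKM : K ∣ M := (dvd_mul_left K N).trans (dvd_mul_left _ _)
  have hNM : N ∣ M := (dvd_mul_right N K).trans (dvd_mul_left _ _)
  obtain ⟨r, hr⟩ := exists_rat_valued_sub_le hy (mul_ne_zero hM hK)
  have hr1 (v) : Valued.v (algebraMap F (v.adicCompletion F) r / y.val.2 v - 1) ≤
      Valued.v (M : v.adicCompletion F) := by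
    have h1 : algebraMap F (v.adicCompletion F) r / y.val.2 v - 1 =
        -((y.val.2 v - algebraMap F (v.adicCompletion F) r) / y.val.2 v) := by
      have := component_ne_zero y v
      field_simp
      ring
    rw [h1, Valuation.map_neg, map_div₀, div_le_iff₀ (zero_lt_iff.2 (hy0 v))]
    refine (hr v).trans ?_
    rw [Nat.cast_mul, map_mul]
    exact mul_le_mul_right (hK1 v) _
  have hr2 (v) : v.valuation F (r : F) ≤ Valued.v (y.val.2 v) := by
    have h1 : Valued.v (algebraMap F (v.adicCompletion F) r / y.val.2 v) ≤ 1 := by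
      rw [← sub_add_cancel (algebraMap F (v.adicCompletion F) r / y.val.2 v) 1]
      exact Valuation.map_add_le _ ((hr1 v).trans (valued_natCast_le_one v M)) (map_one _).le
    rwa [map_div₀, div_le_one₀ (zero_lt_iff.2 (hy0 v)), valued_algebraMap] at h1
  obtain ⟨n, hn⟩ := exists_intCast_eq_of_forall_valuation_le_one (F := F) (q := K * r) fun v ↦ by
    rw [Rat.cast_mul, map_mul, Rat.cast_natCast, ← valued_algebraMap v (K : F), map_natCast]
    exact (mul_le_mul_right (hr2 v) _).trans (hK2 v)
  -- `r = 0` would force `M` to be a unit at all places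
  have hr0 : r ≠ 0 := by
    rintro rfl
    obtain ⟨m, hm⟩ := exists_intCast_eq_of_forall_valuation_le_one (F := F)
      (q := (2 : ℚ)⁻¹) fun v ↦ by
        have h1 := hr1 v
        rw [Rat.cast_zero, map_zero, zero_div, zero_sub, Valuation.map_neg, map_one] at h1
        have h2 := h1.trans (valued_natCast_le_of_dvd (F := F) v (m := 2) (n := M)
          (((by norm_num : 2 ∣ 4).mul_right D).mul_right _))
        rw [Rat.cast_inv, map_inv₀, Rat.cast_ofNat, ← Nat.cast_ofNat (n := 2),
          ← valued_algebraMap, map_natCast]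
        exact inv_le_one_of_one_le₀ h2
    have h3 : ((2 * m : ℤ) : ℚ) = 1 := by
      push_cast
      rw [hm]
      norm_num
    have h4 : 2 * m = 1 := by exact_mod_cast h3
    omega
  have hK0 : (K : ℚ) ≠ 0 := Nat.cast_ne_zero.2 hK
  have hn0 : n ≠ 0 := by
    rintro rfl
    rw [Int.cast_zero, eq_comm] at hn
    exact mul_ne_zero hK0 hr0 hn
  -- replace the part `s` of `K * r` prime to `M` by a prime `± q` that splits in `F`
  obtain ⟨m, s, j, hms, hmM, hsM⟩ := exists_eq_mul_isCoprime (M := M) hn0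
  obtain ⟨q, ε, hq, hε, hqs, hsq⟩ := exists_prime_isSquare hD hM (dvd_mul_right (4 * D) _) hsM
  have hε2 : ε * ε = 1 := by rcases hε with rfl | rfl <;> norm_num
  have hqM : IsCoprime (q : ℤ) M := by
    obtain ⟨k, hk⟩ := hqs
    have h1 : (q : ℤ) = ε * s + M * k := by rw [← hk]; ring
    rw [h1]
    have h2 : IsCoprime ε (M : ℤ) := ⟨ε, 0, by rw [hε2]; ring⟩
    exact (h2.mul_left hsM).add_mul_left_left k
  have hm0 : m ≠ 0 := by
    rintro rfl
    exact hn0 (by rw [hms]; simp)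
  have hb0 : (m : ℚ) / K * (ε * q) ≠ 0 := by
    refine mul_ne_zero (div_ne_zero (Nat.cast_ne_zero.2 hm0) hK0) (mul_ne_zero ?_ ?_)
    · rcases hε with rfl | rfl <;> norm_num
    · exact Nat.cast_ne_zero.2 hq.ne_zero
  let b : Fˣ := Units.mk0 (((m : ℚ) / K * (ε * q) : ℚ) : F) (Rat.cast_ne_zero.2 hb0)
  have hrs : r = m / K * s := by
    have h1 : (K : ℚ) * r = m * s := by rw [← hn, hms]; push_cast; rfl
    field_simp
    linear_combination h1
  have hYr (v : HeightOneSpectrum (𝓞 F)) : (principalIdele F b / y).val.2 v =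
      ((m : v.adicCompletion F) / K * (ε * q)) / y.val.2 v := by
    rw [component_div]
    congr 1
    change algebraMap F (v.adicCompletion F) (((m : ℚ) / K * (ε * q) : ℚ) : F) = _
    push_cast
    simp
  have hrv (v : HeightOneSpectrum (𝓞 F)) : algebraMap F (v.adicCompletion F) r =
      (m : v.adicCompletion F) / K * s := by
    rw [hrs]
    push_cast
    simp
  -- the idele `b / y` is a unit up to `q`, and is congruent to `1` modulo `M`
  have hY1 (v : HeightOneSpectrum (𝓞 F)) (hv : Valued.v (M : v.adicCompletion F) ≠ 1) :
      Valued.v ((principalIdele F b / y).val.2 v - 1) ≤ Valued.v (M : v.adicCompletion F) := by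
    have hs1 := valued_intCast_eq_one_of_isCoprime hsM hv
    have h1 : Valued.v ((m : v.adicCompletion F) / K / y.val.2 v) ≤ 1 := by
      have h2 := hr2 v
      rw [← valued_algebraMap, hrv, map_mul, hs1, mul_one] at h2
      rw [map_div₀]
      exact div_le_one_of_le₀ h2 zero_le
    have h3 : (principalIdele F b / y).val.2 v - 1 =
        (algebraMap F (v.adicCompletion F) r / y.val.2 v - 1) +
          (m : v.adicCompletion F) / K / y.val.2 v * (ε * q - s) := by
      rw [hYr, hrv]
      ring
    rw [h3]
    refine Valuation.map_add_le _ (hr1 v) ?_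
    obtain ⟨k, hk⟩ := hqs
    have h4 : (ε : v.adicCompletion F) * q - s = M * ((ε * k : ℤ) : v.adicCompletion F) := by
      have h5 : ε * q - s = M * (ε * k) := by linear_combination ε * hk + s * hε2
      exact_mod_cast congrArg (Int.cast : ℤ → v.adicCompletion F) h5
    rw [map_mul, h4, map_mul]
    refine (mul_le_of_le_one_left' h1).trans (mul_le_of_le_one_right' ?_)
    rw [← map_intCast (algebraMap F (v.adicCompletion F)), valued_algebraMap,
      ← map_intCast (algebraMap (𝓞 F) F)]
    exact v.valuation_le_one _
  have hY2 (v : HeightOneSpectrum (𝓞 F)) : Valued.v ((principalIdele F b / y).val.2 v) =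
      Valued.v (q : v.adicCompletion F) := by
    by_cases hv : Valued.v (M : v.adicCompletion F) = 1
    · have h1 : Valued.v (K : v.adicCompletion F) = 1 :=
        le_antisymm (valued_natCast_le_one v K) (hv ▸ valued_natCast_le_of_dvd v hKM)
      have h2 : Valued.v (m : v.adicCompletion F) = 1 := by
        refine le_antisymm (valued_natCast_le_one v m) ?_
        have h3 := valued_natCast_le_of_dvd (F := F) v hmM
        rwa [Nat.cast_pow, map_pow, hv, one_pow] at h3
      have h4 : Valued.v (ε : v.adicCompletion F) = 1 := by
        rcases hε with rfl | rfl <;> simp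
      rw [hYr, map_div₀, map_mul, map_div₀, map_mul, h1, h2, h4, hK3 v h1]
      simp
    · have h1 : Valued.v (q : v.adicCompletion F) = 1 := by
        exact_mod_cast valued_intCast_eq_one_of_isCoprime hqM hv
      have h2 := Valuation.map_one_add_of_lt (v := Valued.v)
        ((hY1 v hv).trans_lt (lt_of_le_of_ne (valued_natCast_le_one v M) hv))
      rw [h1, ← h2, add_sub_cancel]
  obtain ⟨z, hz1, hz2⟩ := exists_valued_mul_conjIdele_eq hδ hδ' (dvd_mul_right (4 * D) (N * K))
    hq.ne_zero hqM hsq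
  have hU : principalIdele F b / y / (z * conjIdele F z) ∈ congruenceSubgroup F N Set.univ := by
    refine congruenceSubgroup_anti hNM subset_rfl fun v ↦ ?_
    have h1 : Valued.v ((principalIdele F b / y / (z * conjIdele F z)).val.2 v) = 1 := by
      rw [component_div, map_div₀, hY2, hz1, div_self (valued_natCast_ne_zero v hq.ne_zero)]
    refine ⟨h1, fun _ ↦ ?_⟩
    by_cases hv : Valued.v (M : v.adicCompletion F) = 1
    · rw [hv]
      exact Valuation.map_sub_le _ h1.le (map_one _).le
    · rw [component_div, hz2 v hv, div_one]
      exact hY1 v hv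
  have h := hθ _ hU
  rw [map_div, map_div, hF, map_mul, hc, mul_inv_cancel, div_one, one_div, inv_eq_one] at h
  exact h

end Invariant

/-! ### Hilbert 90 for congruence subgroups -/

section Descent

variable {F : Type*} [Field F] [NumberField F] [Algebra.IsQuadraticExtension ℚ F]
  [IsTotallyComplex F]

theorem trace_eq_add_conjugation (x : 𝓞 F) :
    (Algebra.trace ℤ (𝓞 F) x : 𝓞 F) = x + RingOfIntegers.mapRingEquiv (conjugation F) x := by
  apply RingOfIntegers.coe_injective
  have h1 : algebraMap (𝓞 F) F (RingOfIntegers.mapRingEquiv (conjugation F) x) =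
    conjugation F x := rfl
  rw [map_intCast, map_add, h1]
  obtain ⟨q, hq⟩ := exists_ratCast_eq_of_conjugation_eq (x := (x : F) + conjugation F x) (by
    rw [map_add, conjugation_conjugation, add_comm])
  have h2 : Algebra.trace ℚ F (conjugation F x) = Algebra.trace ℚ F (x : F) :=
    Algebra.trace_eq_of_algEquiv (AlgEquiv.ofRingEquiv (R := ℚ) (f := conjugation F)
      fun r ↦ by simp) (x : F)
  have h3 : Algebra.trace ℚ F (q : F) = 2 * q := by
    rw [← eq_ratCast (algebraMap ℚ F), Algebra.trace_algebraMap,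
      Algebra.IsQuadraticExtension.finrank_eq_two, two_nsmul, two_mul]
  have h4 : (Algebra.trace ℤ (𝓞 F) x : ℚ) = q := by
    rw [Algebra.coe_trace_int]
    rw [hq, map_add, h2] at h3
    linarith
  rw [← hq, ← h4, Rat.cast_intCast]

/-- If complex conjugation acts trivially on a residue field, then the place divides the
discriminant, since the trace form degenerates to a form of rank at most one. -/
theorem discr_mem_of_forall_sub_mem {v : HeightOneSpectrum (𝓞 F)}
    (h : ∀ t : 𝓞 F, t - RingOfIntegers.mapRingEquiv (conjugation F) t ∈ v.asIdeal) :
    ((discr F : ℤ) : 𝓞 F) ∈ v.asIdeal := by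
  classical
  rw [← Ideal.Quotient.eq_zero_iff_mem]
  let π := Ideal.Quotient.mk v.asIdeal
  let b := RingOfIntegers.basis F
  have hcard : Fintype.card (Module.Free.ChooseBasisIndex ℤ (𝓞 F)) = 2 := by
    rw [← Module.finrank_eq_card_chooseBasisIndex, RingOfIntegers.rank,
      Algebra.IsQuadraticExtension.finrank_eq_two]
  have : Nontrivial (Module.Free.ChooseBasisIndex ℤ (𝓞 F)) :=
    Fintype.one_lt_card_iff_nontrivial.1 (by omega)
  have h1 : discr F = (Algebra.traceMatrix ℤ b).det := rfl
  have h2 : (Algebra.traceMatrix ℤ b).map (fun n : ℤ ↦ π (n : 𝓞 F)) =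
      Matrix.vecMulVec (fun i ↦ 2 * π (b i)) (fun j ↦ π (b j)) := by
    ext i j
    have h3 := Ideal.Quotient.eq.2 (h (b i * b j))
    rw [Matrix.map_apply, Algebra.traceMatrix_apply, Algebra.traceForm_apply,
      trace_eq_add_conjugation, map_add, ← h3, Matrix.vecMulVec_apply, map_mul]
    ring
  have h4 := (π.comp (Int.castRingHom (𝓞 F))).map_det (Algebra.traceMatrix ℤ b)
  have h5 : (π.comp (Int.castRingHom (𝓞 F))).mapMatrix (Algebra.traceMatrix ℤ b) =
    (Algebra.traceMatrix ℤ b).map (fun n : ℤ ↦ π (n : 𝓞 F)) := rfl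
  rw [h5, h2, Matrix.det_vecMulVec] at h4
  rw [h1]
  exact h4

theorem valued_algebraMap_conjugation (v : HeightOneSpectrum (𝓞 F)) (t : F) :
    localMap (conjugation F) v (algebraMap F _ t) =
      algebraMap F (v.adicCompletion F) (conjugation F t) :=
  localMap_coe _ v t

/-- Hilbert 90 for ideles of norm one in a congruence subgroup. At a place in `S` the explicit
formula `w = (1 + conj u) / 2` applies; at the other places, which are unramified,
`w = t + conj (u * t)` is a unit for a suitable integer `t`, which may be chosen the same at
conjugate places. -/
theorem exists_conjIdele_eq_mul {N : ℕ} {S : Set (HeightOneSpectrum (𝓞 F))}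
    (hS : ∀ v ∈ S, pullPlace (conjugation F) v ∈ S)
    (hSN : ∀ v ∈ S, Valued.v (N : v.adicCompletion F) ≠ 1)
    (hSd : ∀ v ∉ S, ((discr F : ℤ) : 𝓞 F) ∉ v.asIdeal)
    {u : Ideles F} (hu : u ∈ congruenceSubgroup F (2 * N) S)
    (huu : ∀ v, (u * conjIdele F u).val.2 v = 1) :
    ∃ w ∈ congruenceSubgroup F N S, ∀ v, (conjIdele F w).val.2 v = u.val.2 v * w.val.2 v := by
  classical
  let c := conjugation F
  let u' := conjIdele F u
  -- the Hilbert 90 element `t + conj (u * t)`, made from a local choice of `t`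
  let g (v : HeightOneSpectrum (𝓞 F)) (t : F) : v.adicCompletion F :=
    algebraMap F _ t + u'.val.2 v * algebraMap F _ (c t)
  have hg (v : HeightOneSpectrum (𝓞 F)) (t : F) :
      localMap c v (g (pullPlace c v) t) = u.val.2 v * g v t := by
    have h1 : localMap c v (u'.val.2 (pullPlace c v)) = u.val.2 v := by
      rw [← conjIdele_snd, conjIdele_conjIdele]
    have h2 : u.val.2 v * u'.val.2 v = 1 := huu v
    dsimp only [g]
    rw [map_add, map_mul, h1, valued_algebraMap_conjugation, valued_algebraMap_conjugation,
      conjugation_conjugation]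
    linear_combination (-algebraMap F (v.adicCompletion F) (c t)) * h2
  have hgv (v : HeightOneSpectrum (𝓞 F)) (t : F) :
      Valued.v (g (pullPlace c v) t) = Valued.v (g v t) := by
    rw [← valued_localMap c v, hg, map_mul, (hu v).1, one_mul]
  have hS' (v : HeightOneSpectrum (𝓞 F)) : pullPlace c v ∈ S ↔ v ∈ S :=
    ⟨fun h ↦ pullPlace_pullPlace v ▸ hS _ h, hS v⟩
  let T (v : HeightOneSpectrum (𝓞 F)) : Set F :=
    if v ∈ S then {1 / 2} else {t | (∃ r : 𝓞 F, (r : F) = t) ∧ Valued.v (g v t) = 1}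
  have hT (v : HeightOneSpectrum (𝓞 F)) : T (pullPlace c v) = T v := by
    dsimp only [T]
    simp only [hS', hgv]
  have hu'v (v : HeightOneSpectrum (𝓞 F)) : Valued.v (u'.val.2 v) = 1 := by
    rw [valued_conjIdele]
    exact (hu _).1
  have hne (v : HeightOneSpectrum (𝓞 F)) : (T v).Nonempty := by
    dsimp only [T]
    split_ifs with hv
    · exact ⟨_, rfl⟩
    by_contra hempty
    have hlt (r : 𝓞 F) : Valued.v (g v r) < 1 := by
      refine lt_of_le_of_ne (Valuation.map_add_le _ ?_ ?_) fun h ↦ hempty ⟨r, ⟨r, rfl⟩, h⟩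
      · rw [valued_algebraMap]
        exact v.valuation_le_one r
      · rw [map_mul, hu'v, one_mul, valued_algebraMap]
        exact v.valuation_le_one (RingOfIntegers.mapRingEquiv c r)
    refine hSd v hv (discr_mem_of_forall_sub_mem fun t ↦ ?_)
    rw [← HeightOneSpectrum.valuation_lt_one_iff_mem (K := F), ← valued_algebraMap]
    have h1 : algebraMap F (v.adicCompletion F) (algebraMap (𝓞 F) F
        (t - RingOfIntegers.mapRingEquiv (conjugation F) t)) =
        g v t - g v (1 : 𝓞 F) * algebraMap F _ (c t) := by
      have h2 : algebraMap (𝓞 F) F (t - RingOfIntegers.mapRingEquiv (conjugation F) t) =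
        t - c t := map_sub _ _ _
      have h3 : ((1 : 𝓞 F) : F) = 1 := map_one _
      dsimp only [g]
      rw [h2, map_sub, h3, map_one c, map_one]
      ring
    rw [h1]
    refine Valuation.map_sub_lt _ (hlt t) ?_
    rw [map_mul]
    refine (mul_le_of_le_one_right' ?_).trans_lt (hlt 1)
    rw [valued_algebraMap]
    exact v.valuation_le_one (RingOfIntegers.mapRingEquiv c t)
  -- `τ` is a function of the set `T v`, so that it takes the same value at conjugate places
  let τ (s : Set F) : F := if h : s.Nonempty then h.some else 0
  have hτ (v : HeightOneSpectrum (𝓞 F)) : τ (T v) ∈ T v := by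
    dsimp only [τ]
    rw [dif_pos (hne v)]
    exact (hne v).some_mem
  have hτS (v : HeightOneSpectrum (𝓞 F)) (hv : v ∈ S) : τ (T v) = 1 / 2 := by
    have h := hτ v
    have h1 : T v = {1 / 2} := if_pos hv
    rwa [h1] at h ⊢
  have hτS' (v : HeightOneSpectrum (𝓞 F)) (hv : v ∉ S) : Valued.v (g v (τ (T v))) = 1 := by
    have h := hτ v
    have h1 : T v = {t | (∃ r : 𝓞 F, (r : F) = t) ∧ Valued.v (g v t) = 1} := if_neg hv
    rw [h1] at h ⊢
    exact h.2
  have hw1 (v : HeightOneSpectrum (𝓞 F)) (hv : v ∈ S) :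
      Valued.v (g v (τ (T v)) - 1) ≤ Valued.v (N : v.adicCompletion F) := by
    have h2 : Valued.v ((2 : ℕ) : v.adicCompletion F) ≠ 0 := valued_natCast_ne_zero v two_ne_zero
    have h3 : (2 : v.adicCompletion F) ≠ 0 := fun h ↦ h2 (by rw [Nat.cast_ofNat, h, map_zero])
    have h4 : ((2 : ℕ) : v.adicCompletion F) * (g v (τ (T v)) - 1) = u'.val.2 v - 1 := by
      dsimp only [g]
      rw [hτS v hv, map_div₀ c, map_one, map_ofNat, map_div₀, map_one, map_ofNat]
      push_cast
      field_simp
      ring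
    have h5 := (conjIdele_mem_congruenceSubgroup hS hu v).2 hv
    change Valued.v (u'.val.2 v - 1) ≤ _ at h5
    rw [← h4, map_mul, Nat.cast_mul, map_mul] at h5
    exact (mul_le_mul_iff_right₀ (zero_lt_iff.2 h2)).1 h5
  have hw2 (v : HeightOneSpectrum (𝓞 F)) : Valued.v (g v (τ (T v))) = 1 := by
    by_cases hv : v ∈ S
    · have h := Valuation.map_one_add_of_lt (v := Valued.v)
        ((hw1 v hv).trans_lt (lt_of_le_of_ne (valued_natCast_le_one v N) (hSN v hv)))
      rwa [add_sub_cancel] at h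
    · exact hτS' v hv
  refine ⟨finiteIdele (fun v ↦ g v (τ (T v))) (fun v h ↦ ?_) (.of_forall hw2),
    fun v ↦ ⟨hw2 v, hw1 v⟩, fun v ↦ ?_⟩
  · have h1 := hw2 v
    rw [h, map_zero] at h1
    exact zero_ne_one h1
  · change localMap c v (g (pullPlace c v) (τ (T (pullPlace c v)))) = u.val.2 v * g v (τ (T v))
    rw [hT, hg]

/-- A character that is trivial on ideles congruent to `1` modulo `N` and unramified at the places
outside `S` that divide `N` is trivial on ideles congruent to `1` modulo `N` at the places in
`S`. -/
theorem eq_one_of_mem_congruenceSubgroup {A : Type*} [CommGroup A] (θ : Ideles F →* A) {N : ℕ}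
    (hN : N ≠ 0) {S : Set (HeightOneSpectrum (𝓞 F))}
    (hθ : ∀ x ∈ congruenceSubgroup F N Set.univ, θ x = 1)
    (hS : ∀ v ∉ S, Valued.v (N : v.adicCompletion F) ≠ 1 → ∀ x : Ideles F, x.val.1 = 1 →
      (∀ w, w ≠ v → x.val.2 w = 1) → Valued.v (x.val.2 v) = 1 → θ x = 1)
    {x : Ideles F} (hx : x ∈ congruenceSubgroup F N S) : θ x = 1 := by
  classical
  -- remove the places outside `S` one at a time
  have key (T : Finset (HeightOneSpectrum (𝓞 F)))
      (hT : ∀ v ∈ T, v ∉ S ∧ Valued.v (N : v.adicCompletion F) ≠ 1) :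
      ∀ x ∈ congruenceSubgroup F N {v | v ∉ T}, θ x = 1 := by
    induction T using Finset.induction_on with
    | empty =>
      intro x hx
      exact hθ x (by simpa using hx)
    | insert a T ha ih =>
      intro x hx
      let f : ∀ v : HeightOneSpectrum (𝓞 F), v.adicCompletion F :=
        Function.update (fun _ ↦ 1) a (x.val.2 a)
      have hfa : f a = x.val.2 a := Function.update_self ..
      have hf (v) (hv : v ≠ a) : f v = 1 := Function.update_of_ne hv ..
      have hf1 (v) : Valued.v (f v) = 1 := by
        by_cases hv : v = a
        · subst hv
          rw [hfa, (hx v).1]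
        · rw [hf v hv, map_one]
      let z := finiteIdele f (fun v h ↦ zero_ne_one (by rw [← hf1 v, h, map_zero]))
        (.of_forall hf1)
      have hz : θ z = 1 := hS a (hT a (Finset.mem_insert_self a T)).1
        (hT a (Finset.mem_insert_self a T)).2 z rfl hf (hf1 a)
      have hxz : θ (x / z) = 1 := by
        refine ih (fun v hv ↦ hT v (Finset.mem_insert_of_mem hv)) _ fun v ↦ ?_
        have h1 : (x / z).val.2 v = x.val.2 v / f v := component_div x z v
        rw [h1]
        refine ⟨by rw [map_div₀, (hx v).1, hf1, div_one], fun hv ↦ ?_⟩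
        by_cases hva : v = a
        · subst hva
          rw [hfa, div_self (component_ne_zero x v), sub_self, map_zero]
          exact zero_le
        · rw [hf v hva, div_one]
          exact (hx v).2 fun h ↦ (Finset.mem_insert.1 h).elim hva hv
      rw [← div_mul_cancel x z, map_mul, hxz, hz, one_mul]
  have hfin := (finite_valued_ne_one (F := F) hN).subset
    (Set.inter_subset_left (t := Sᶜ))
  refine key hfin.toFinset (fun v hv ↦ ?_) x fun v ↦ ⟨(hx v).1, fun hv ↦ ?_⟩
  · rw [Set.Finite.mem_toFinset] at hv
    exact ⟨hv.2, hv.1⟩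
  · by_cases hvS : v ∈ S
    · exact (hx v).2 hvS
    · have h1 : Valued.v (N : v.adicCompletion F) = 1 := by
        by_contra h
        exact hv (hfin.mem_toFinset.2 ⟨h, hvS⟩)
      rw [h1]
      exact Valuation.map_sub_le _ (hx v).1.le (map_one _).le

/-- A character of the idele class group that is inverted by complex conjugation is trivial on
ideles whose class in a ray class group of sufficiently high level is invariant. -/
theorem eq_one_of_conjIdele_div_mem {A : Type*} [CommGroup A] (θ : Ideles F →* A)
    (hF : ∀ a, θ (principalIdele F a) = 1) {N : ℕ} (hN : N ≠ 0)
    {S : Set (HeightOneSpectrum (𝓞 F))}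
    (hS : ∀ v ∈ S, pullPlace (conjugation F) v ∈ S)
    (hSN : ∀ v ∈ S, Valued.v (N : v.adicCompletion F) ≠ 1)
    (hSd : ∀ v ∉ S, ((discr F : ℤ) : 𝓞 F) ∉ v.asIdeal)
    (hθ : ∀ x ∈ congruenceSubgroup F N S, θ x = 1)
    (hc : ∀ x, θ (conjIdele F x) = (θ x)⁻¹) {x : Ideles F}
    (hx : conjIdele F x / x ∈ (principalIdele F).range ⊔ congruenceSubgroup F (2 * N) S) :
    θ x = 1 := by
  obtain ⟨_, ⟨a, rfl⟩, u, hu, hau⟩ := Subgroup.mem_sup.1 hx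
  have hdiv (y : Ideles F) : conjIdele F y / y * conjIdele F (conjIdele F y / y) = 1 := by
    rw [map_div, conjIdele_conjIdele, div_mul_div_cancel, div_self']
  have hnorm : (principalIdele F a * conjIdele F (principalIdele F a)) *
      (u * conjIdele F u) = 1 := by
    have h1 := hdiv x
    rw [← hau, map_mul] at h1
    rw [← h1]
    ac_rfl
  -- the norms of `a` and `u` are inverse to each other; both are `1` by positivity of norms, and
  -- Hilbert 90 applies to `a` in the field and to `u` in the congruence subgroup
  have ha : (a : F) * conjugation F a = 1 := by
    refine mul_conjugation_eq_one a.ne_zero fun v ↦ ?_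
    have h1 := congrArg (fun y : Ideles F ↦ Valued.v (y.val.2 v)) hnorm
    have h2 : ((principalIdele F a * conjIdele F (principalIdele F a)) *
        (u * conjIdele F u)).val.2 v =
        algebraMap F (v.adicCompletion F) (a * conjugation F a) *
          (u.val.2 v * (conjIdele F u).val.2 v) := by
      rw [conjIdele_principalIdele, map_mul]
      rfl
    have h3 : (1 : Ideles F).val.2 v = 1 := rfl
    rwa [h2, h3, Valuation.map_mul, Valuation.map_mul, (hu v).1,
      (conjIdele_mem_congruenceSubgroup hS hu v).1, one_mul, mul_one, Valuation.map_one,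
      valued_algebraMap] at h1
  obtain ⟨b, hb, hab⟩ := exists_eq_conjugation_div ha
  let β : Fˣ := Units.mk0 b hb
  have haβ : principalIdele F a = conjIdele F (principalIdele F β) / principalIdele F β := by
    rw [conjIdele_principalIdele, ← map_div]
    congr 1
    apply Units.ext
    rw [Units.val_div_eq_div_val]
    exact hab
  have hbu : conjIdele F (x / principalIdele F β) / (x / principalIdele F β) = u := by
    rw [map_div, div_div_div_comm, ← haβ, ← hau, mul_div_cancel_left]
  have huu : u * conjIdele F u = 1 := by
    rw [← hbu]
    exact hdiv _
  obtain ⟨w, hw, hwu⟩ := exists_conjIdele_eq_mul hS hSN hSd hu fun v ↦ by rw [huu]; rfl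
  have hinv : θ (x / principalIdele F β / w) = 1 := by
    refine eq_one_of_conjIdele_eq θ hF hN
      (fun y hy ↦ hθ y (congruenceSubgroup_anti dvd_rfl (Set.subset_univ S) hy)) hc fun v ↦ ?_
    have h1 : (conjIdele F (x / principalIdele F β)).val.2 v =
        u.val.2 v * (x / principalIdele F β).val.2 v := by
      have h2 : conjIdele F (x / principalIdele F β) = u * (x / principalIdele F β) := by
        rw [← hbu, div_mul_cancel]
      rw [h2]
      rfl
    rw [map_div (conjIdele F), component_div, component_div, h1, hwu,
      mul_div_mul_left _ _ (component_ne_zero u v)]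
  rwa [map_div, map_div, hF, hθ w hw, div_one, div_one] at hinv

end Descent

/-! ### Extension of characters -/

section Extension

/-- Since `ℂˣ` is divisible, a character trivial on the kernel of a homomorphism factors through
it. -/
theorem exists_monoidHom_comp_eq {G H : Type*} [CommGroup G] [CommGroup H] (f : G →* H)
    (θ : G →* ℂˣ) (h : f.ker ≤ θ.ker) : ∃ g : H →* ℂˣ, ∀ x, g (f x) = θ x := by
  have hroot : ∀ {n : ℕ}, n ≠ 0 → Function.Surjective (fun a : ℂˣ ↦ a ^ n) := by
    intro n hn a
    obtain ⟨z, hz⟩ := IsAlgClosed.exists_pow_nat_eq (a : ℂ) (Nat.pos_of_ne_zero hn)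
    have hz0 : z ≠ 0 := by
      rintro rfl
      rw [zero_pow hn] at hz
      exact a.ne_zero hz.symm
    exact ⟨Units.mk0 z hz0, Units.ext hz⟩
  let _ : DivisibleBy (Additive ℂˣ) ℕ := divisibleByOfSMulRightSurj _ _ fun {n} hn ↦
    hroot hn
  let _ : DivisibleBy (Additive ℂˣ) ℤ := AddGroup.divisibleByIntOfDivisibleByNat _
  obtain ⟨g, hg⟩ := (Module.Baer.of_divisible (Additive ℂˣ)).extension_property_addMonoidHom
    (MonoidHom.toAdditive (QuotientGroup.kerLift f)) (QuotientGroup.kerLift_injective f)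
    (MonoidHom.toAdditive (QuotientGroup.lift f.ker θ h))
  exact ⟨MonoidHom.toAdditive.symm g, fun x ↦
    DFunLike.congr_fun hg (Additive.ofMul (x : G ⧸ f.ker))⟩

/-- If `θ` is trivial on the elements whose class modulo `B` is fixed by `c`, then it has the form
`x ↦ g (c x / x)` for a character `g` of the quotient by `B`. -/
theorem exists_apply_div_eq {G : Type*} [CommGroup G] (c : G →* G) (B : Subgroup G) (θ : G →* ℂˣ)
    (h : ∀ x, c x / x ∈ B → θ x = 1) :
    ∃ g : G →* ℂˣ, (∀ x ∈ B, g x = 1) ∧ ∀ x, g (c x / x) = θ x := by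
  obtain ⟨g, hg⟩ := exists_monoidHom_comp_eq ((QuotientGroup.mk' B).comp (c / MonoidHom.id G)) θ
    fun x hx ↦ h x ((QuotientGroup.eq_one_iff (c x / x)).1 hx)
  refine ⟨g.comp (QuotientGroup.mk' B), fun x hx ↦ ?_, hg⟩
  have hx' : QuotientGroup.mk' B x = 1 := (QuotientGroup.eq_one_iff x).2 hx
  rw [MonoidHom.comp_apply, hx', map_one]

end Extension

/-! ### Ramification and infinity types -/

section Characters

variable {F : Type*} [Field F] [NumberField F]

namespace HeckeCharacter

theorem mul_apply (χ ψ : HeckeCharacter F) (x : Ideles F) : (χ * ψ).1 x = χ.1 x * ψ.1 x := rfl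

theorem div_apply (χ ψ : HeckeCharacter F) (x : Ideles F) : (χ / ψ).1 x = χ.1 x / ψ.1 x := by
  rw [div_eq_mul_inv, div_eq_mul_inv]
  rfl

theorem pow_apply (χ : HeckeCharacter F) (n : ℕ) (x : Ideles F) : (χ ^ n).1 x = χ.1 x ^ n := by
  induction n with
  | zero => rfl
  | succ n ih => rw [pow_succ, pow_succ, mul_apply, ih]

theorem ext_apply {χ ψ : HeckeCharacter F} (h : ∀ x, χ.1 x = ψ.1 x) : χ = ψ :=
  Subtype.ext (ContinuousMonoidHom.ext h)

/-- The absolute value on `ℂ`, with values in `ℂ`, as a monoid homomorphism. -/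
def absHom : ℂ →* ℂ where
  toFun z := (‖z‖ : ℂ)
  map_one' := by rw [norm_one, Complex.ofReal_one]
  map_mul' z w := by rw [norm_mul, Complex.ofReal_mul]

theorem continuous_absHom : Continuous absHom := Complex.continuous_ofReal.comp continuous_norm

/-- The absolute value `x ↦ |χ x|` of a Hecke character. -/
def abs (χ : HeckeCharacter F) : HeckeCharacter F :=
  ⟨ContinuousMonoidHom.comp ⟨Units.map absHom, continuous_absHom.units_map absHom⟩ χ.1,
    fun a ↦ by
      change Units.map absHom (χ.1 (principalIdele F a)) = 1
      rw [χ.2 a, map_one]⟩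

theorem abs_apply (χ : HeckeCharacter F) (x : Ideles F) :
    ((χ.abs.1 x : ℂˣ) : ℂ) = (‖((χ.1 x : ℂˣ) : ℂ)‖ : ℂ) := rfl

theorem isUnramifiedAt_of_not_dvd_conductor {χ : HeckeCharacter F}
    {v : HeightOneSpectrum (𝓞 F)} (h : ¬ v.asIdeal ∣ χ.conductor) : χ.IsUnramifiedAt v := by
  obtain ⟨I, hI, hIv⟩ : ∃ I, χ.HasLevel I ∧ ¬ I ≤ v.asIdeal := by
    by_contra! hle
    exact h (Ideal.dvd_iff_le.2 (sSup_le hle))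
  obtain ⟨r, hrI, hrv⟩ := Set.not_subset.1 hIv
  intro x hx hx1 hxv
  refine hI x hx fun w ↦ ?_
  by_cases hw : w = v
  · subst hw
    refine ⟨hxv, ⟨x.val.2 w - 1, Valuation.map_sub_le _ hxv.le (map_one _).le⟩, ?_, rfl⟩
    have htop : I.map (algebraMap (𝓞 F) (w.adicCompletionIntegers F)) = ⊤ := by
      refine Ideal.eq_top_of_isUnit_mem _ (Ideal.mem_map_of_mem _ hrI) ?_
      rw [HeightOneSpectrum.adicCompletionIntegers.isUnit_iff_valued_eq_one]
      exact (HeightOneSpectrum.valuedAdicCompletion_eq_valuation w r).trans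
        ((HeightOneSpectrum.valuation_eq_one_iff_notMem (K := F) w).2 hrv)
    rw [htop]
    trivial
  · rw [hx1 w hw]
    exact ⟨map_one _, 0, zero_mem _, (sub_self _).symm⟩

end HeckeCharacter

theorem embeddingExtension_coe (ι : F →+* ℂ) (k : F) :
    embeddingExtension ι (k : (InfinitePlace.mk ι).Completion) = ι k :=
  (isometry_embedding_mk ι).extensionHom_coe _

theorem continuous_embeddingExtension (ι : F →+* ℂ) : Continuous (embeddingExtension ι) :=
  UniformSpace.Completion.continuous_extension.comp
    (InfinitePlace.Completion.continuous_toCompletion _)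

end Characters

section ConjugateCharacters

variable {F : Type*} [Field F] [NumberField F] [Algebra.IsQuadraticExtension ℚ F]
  [IsTotallyComplex F]

theorem embeddingExtension_conjIdele (ι : F →+* ℂ) (x : Ideles F) :
    embeddingExtension ι ((conjIdele F x).val.1 (InfinitePlace.mk ι)) =
      starRingEnd ℂ (embeddingExtension ι (x.val.1 (InfinitePlace.mk ι))) := by
  have key (w : InfinitePlace F) (h : w = InfinitePlace.mk ι) (g : w.Completion →+* ℂ)
      (hg : Continuous g) (hg' : ∀ k : F, g (k : w.Completion) = starRingEnd ℂ (ι k)) :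
      g (x.val.1 w) =
        starRingEnd ℂ (embeddingExtension ι (x.val.1 (InfinitePlace.mk ι))) := by
    subst h
    refine congrFun ((denseRange_infinitePlace_coe (InfinitePlace.mk ι)).equalizer hg
      (Complex.continuous_conj.comp (continuous_embeddingExtension ι)) (funext fun k ↦ ?_)) _
    exact (hg' k).trans (congrArg _ (embeddingExtension_coe ι k).symm)
  refine key ((InfinitePlace.mk ι).comap (conjugation F : F →+* F))
    (infinitePlace_comap_conjugation _)
    ((embeddingExtension ι).comp (infiniteLocalMap (conjugation F) (InfinitePlace.mk ι)))
    ((continuous_embeddingExtension ι).comp (continuous_infiniteLocalMap _ _)) fun k ↦ ?_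
  rw [RingHom.comp_apply, infiniteLocalMap_coe, embeddingExtension_coe, embedding_conjugation]

theorem HeckeCharacter.IsUnramifiedAt.conj {χ : HeckeCharacter F}
    {v : HeightOneSpectrum (𝓞 F)} (h : χ.IsUnramifiedAt (pullPlace (conjugation F) v)) :
    χ.conj.IsUnramifiedAt v := by
  intro x hx hx1 hxv
  rw [HeckeCharacter.conj_apply]
  refine h _ (conjIdele_fst hx) (fun w hw ↦ ?_) ?_
  · rw [conjIdele_snd, hx1, map_one]
    intro hwv
    exact hw (by rw [← hwv, pullPlace_pullPlace])
  · rw [valued_conjIdele, pullPlace_pullPlace]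
    exact hxv

theorem dvd_map_conjugation_iff (v : HeightOneSpectrum (𝓞 F)) (I : Ideal (𝓞 F)) :
    v.asIdeal ∣ I.map (RingOfIntegers.mapRingEquiv (conjugation F)) ↔
      (pullPlace (conjugation F) v).asIdeal ∣ I := by
  rw [Ideal.dvd_iff_le, Ideal.dvd_iff_le, Ideal.map_le_iff_le_comap]
  rfl

theorem pullPlace_mem_badPlaces {p : ℕ} {φ₁ φ₂ : HeckeCharacter F}
    {v : HeightOneSpectrum (𝓞 F)} (hv : v ∈ badPlaces p φ₁ φ₂) :
    pullPlace (conjugation F) v ∈ badPlaces p φ₁ φ₂ := by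
  have hint : (pullPlace (conjugation F) v).asIdeal ∣ Ideal.span {((p * discr F : ℤ) : 𝓞 F)} ↔
      v.asIdeal ∣ Ideal.span {((p * discr F : ℤ) : 𝓞 F)} := by
    have h := mem_pullPlace_pow (conjugation F) v 1 ((p * discr F : ℤ) : 𝓞 F)
    rw [pow_one, pow_one, map_intCast] at h
    rw [Ideal.dvd_span_singleton, Ideal.dvd_span_singleton, h]
  simp only [badPlaces, Set.mem_ofPred_eq, dvd_map_conjugation_iff, pullPlace_pullPlace, hint]
    at hv ⊢
  tauto

theorem discr_notMem_of_notMem_badPlaces {p : ℕ} {φ₁ φ₂ : HeckeCharacter F}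
    {v : HeightOneSpectrum (𝓞 F)} (hv : v ∉ badPlaces p φ₁ φ₂) :
    ((discr F : ℤ) : 𝓞 F) ∉ v.asIdeal := by
  intro h
  refine hv (.inr (.inr (.inr (.inr ?_))))
  rw [Ideal.dvd_span_singleton, Int.cast_mul]
  exact Ideal.mul_mem_left _ _ h

/-- A Hecke character with trivial infinity type that is ramified only at places in `P` is trivial
on a congruence subgroup with conditions only at places in `P`. -/
theorem HeckeCharacter.exists_trivial_on_congruenceSubgroup {P : Set (HeightOneSpectrum (𝓞 F))}
    (hP : ∀ v ∈ P, pullPlace (conjugation F) v ∈ P)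
    (hPd : ∀ v ∉ P, ((discr F : ℤ) : 𝓞 F) ∉ v.asIdeal) (θ : HeckeCharacter F)
    (hinf : ∀ x : Ideles F, x.val.2 = 1 → θ.1 x = 1) (hur : ∀ v ∉ P, θ.IsUnramifiedAt v) :
    ∃ (N : ℕ) (S : Set (HeightOneSpectrum (𝓞 F))), N ≠ 0 ∧ S ⊆ P ∧
      (∀ v ∈ S, pullPlace (conjugation F) v ∈ S) ∧
      (∀ v ∈ S, Valued.v (N : v.adicCompletion F) ≠ 1) ∧
      (∀ v ∉ S, ((discr F : ℤ) : 𝓞 F) ∉ v.asIdeal) ∧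
      ∀ x ∈ congruenceSubgroup F N S, θ.1 x = 1 := by
  obtain ⟨N₀, hN₀, hlevel⟩ := θ.exists_level
  -- the factor `discr F` puts all ramified places into `S`
  have hN : N₀ * (discr F).natAbs ≠ 0 :=
    mul_ne_zero hN₀ (Int.natAbs_ne_zero.2 (discr_ne_zero F))
  have hdvd : N₀ ∣ N₀ * (discr F).natAbs := dvd_mul_right _ _
  have hdvd' : (discr F).natAbs ∣ N₀ * (discr F).natAbs := dvd_mul_left _ _
  generalize N₀ * (discr F).natAbs = N at hN hdvd hdvd'
  refine ⟨N, {v | v ∈ P ∧ Valued.v (N : v.adicCompletion F) ≠ 1}, hN, fun v hv ↦ hv.1,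
    fun v hv ↦ ⟨hP v hv.1, by rw [valued_natCast_pullPlace]; exact hv.2⟩, fun v hv ↦ hv.2,
    fun v hv hd ↦ ?_, fun x hx ↦ ?_⟩
  · refine hv ⟨by_contra fun h ↦ hPd v h hd, ?_⟩
    rw [← natCast_mem_iff_valued_ne_one]
    have h1 : (((discr F).natAbs : ℕ) : 𝓞 F) ∈ v.asIdeal := by
      rcases Int.natAbs_eq (discr F) with h | h <;> rw [h] at hd
      · rwa [Int.cast_natCast] at hd
      · rwa [Int.cast_neg, neg_mem_iff, Int.cast_natCast] at hd
    obtain ⟨k, rfl⟩ := hdvd'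
    rw [Nat.cast_mul]
    exact Ideal.mul_mem_right _ _ h1
  · refine eq_one_of_mem_congruenceSubgroup
      (S := {v | v ∈ P ∧ Valued.v (N : v.adicCompletion F) ≠ 1}) θ.1.toMonoidHom hN (fun x hx ↦ ?_)
      (fun v hv hvN ↦ hur v fun hvP ↦ hv ⟨hvP, hvN⟩) hx
    -- the condition at infinity extends triviality from finite ideles to all ideles
    let y := finiteIdele (fun v ↦ x.val.2 v) (component_ne_zero x)
      (eventually_valued_component x)
    have h1 : θ.1 (x / y) = 1 := by
      refine hinf _ (FiniteAdeleRing.ext F fun v ↦ ?_)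
      rw [component_div]
      exact div_self (component_ne_zero x v)
    have h2 : θ.1 y = 1 := hlevel y (fun v ↦
      congruenceSubgroup_anti hdvd subset_rfl hx v) rfl
    change θ.1 x = 1
    rw [← div_mul_cancel x y, map_mul, h1, h2, one_mul]

/-- A character of the ideles that is trivial on principal ideles and on a congruence subgroup is
a Hecke character of finite order, as ray class groups have finite exponent. -/
theorem exists_heckeCharacter_isOfFinOrder (g : Ideles F →* ℂˣ)
    (hF : ∀ a, g (principalIdele F a) = 1) {N : ℕ} (hN : N ≠ 0)
    {S : Set (HeightOneSpectrum (𝓞 F))} (hg : ∀ x ∈ congruenceSubgroup F N S, g x = 1) :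
    ∃ η : HeckeCharacter F, (∀ x, η.1 x = g x) ∧ IsOfFinOrder η ∧
      ∀ v ∉ S, η.IsUnramifiedAt v := by
  have hcont : Continuous g := by
    refine continuous_of_continuousAt_one _ ?_
    refine ContinuousAt.congr (f := fun _ ↦ 1) continuousAt_const ?_
    filter_upwards [(isOpen_congruenceSubgroup hN S).mem_nhds (one_mem _)] with x hx
    exact (hg x hx).symm
  let η : HeckeCharacter F := ⟨⟨g, hcont⟩, hF⟩
  have hη (x : Ideles F) : η.1 x = g x := rfl
  refine ⟨η, hη, ?_, fun v hv x hx hx1 hxv ↦ ?_⟩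
  · obtain ⟨e, he, h⟩ := exists_pow_div_mem_congruenceSubgroup (F := F) hN
    refine isOfFinOrder_iff_pow_eq_one.2 ⟨e, he, HeckeCharacter.ext_apply fun x ↦ ?_⟩
    obtain ⟨a, ha⟩ := h x
    rw [HeckeCharacter.pow_apply, ← map_pow, hη,
      ← div_mul_cancel (x ^ e) (principalIdele F a), map_mul, hF, mul_one]
    exact hg _ (congruenceSubgroup_anti dvd_rfl (Set.subset_univ S) ha)
  · rw [hη]
    refine hg x fun w ↦ ?_
    by_cases hw : w = v
    · subst hw
      exact ⟨hxv, fun h ↦ absurd h hv⟩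
    · rw [hx1 w hw, sub_self, map_one, map_zero]
      exact ⟨rfl, fun _ ↦ zero_le⟩

/-- A Hecke character `θ` of an imaginary quadratic field with trivial infinity type that is
inverted by complex conjugation and ramified only at places in `P` has the form `η ^ c / η` for
a Hecke character `η` of finite order ramified only at places in `P`. -/
theorem exists_conj_div_eq {P : Set (HeightOneSpectrum (𝓞 F))}
    (hP : ∀ v ∈ P, pullPlace (conjugation F) v ∈ P)
    (hPd : ∀ v ∉ P, ((discr F : ℤ) : 𝓞 F) ∉ v.asIdeal) (θ : HeckeCharacter F)
    (hinf : ∀ x : Ideles F, x.val.2 = 1 → θ.1 x = 1)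
    (hc : ∀ x, θ.1 (conjIdele F x) = (θ.1 x)⁻¹) (hur : ∀ v ∉ P, θ.IsUnramifiedAt v) :
    ∃ η : HeckeCharacter F, IsOfFinOrder η ∧ (∀ v ∉ P, η.IsUnramifiedAt v) ∧
      η.conj / η = θ := by
  obtain ⟨N, S, hN, hSP, hS, hSN, hSd, hθ⟩ :=
    θ.exists_trivial_on_congruenceSubgroup hP hPd hinf hur
  obtain ⟨θ', hθ'⟩ : ∃ θ' : Ideles F →* ℂˣ, ∀ x, θ' x = θ.1 x :=
    ⟨θ.1.toMonoidHom, fun _ ↦ rfl⟩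
  obtain ⟨g, hgB, hg⟩ := exists_apply_div_eq (conjIdele F)
    ((principalIdele F).range ⊔ congruenceSubgroup F (2 * N) S) θ' fun x hx ↦
      eq_one_of_conjIdele_div_mem θ' (fun a ↦ (hθ' _).trans (θ.2 a)) hN hS hSN hSd
        (fun y hy ↦ (hθ' y).trans (hθ y hy)) (fun y ↦ by rw [hθ', hθ', hc]) hx
  obtain ⟨η, hη, hfin, hηur⟩ := exists_heckeCharacter_isOfFinOrder g
    (fun a ↦ hgB _ (Subgroup.mem_sup_left ⟨a, rfl⟩)) (mul_ne_zero two_ne_zero hN)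
    fun x hx ↦ hgB x (Subgroup.mem_sup_right hx)
  refine ⟨η, hfin, fun v hv ↦ hηur v fun h ↦ hv (hSP h), HeckeCharacter.ext_apply fun x ↦ ?_⟩
  rw [HeckeCharacter.div_apply, HeckeCharacter.conj_apply, hη, hη, ← map_div, hg, hθ']

end ConjugateCharacters

end HeckeTwist

end

open HeckeTwist

theorem mainTheorem11 (F : Type*) [Field F] [NumberField F] [Algebra.IsQuadraticExtension ℚ F]
    [IsTotallyComplex F] (ι : F →+* ℂ) (p : ℕ) (hp : p.Prime) (hpF : ¬ (p : ℤ) ∣ discr F)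
    (φ₁ φ₂ : HeckeTwist.HeckeCharacter F)
    (hφ₁ : φ₁.HasInfinityType ι 1 0) (hφ₂ : φ₂.HasInfinityType ι (-1) 0)
    (hχ : (φ₁ / φ₂).conj = (φ₁ / φ₂).bar) :
    ∃ η : HeckeTwist.HeckeCharacter F, IsOfFinOrder η ∧
      (∀ v, v ∉ HeckeTwist.badPlaces p φ₁ φ₂ → η.IsUnramifiedAt v) ∧
      (φ₁ * φ₂ * η ^ 2).conj = φ₁ * φ₂ * η ^ 2 := by
  -- `θ ^ 2` is the quotient of `φ₁ * φ₂` by its conjugate, and `θ` is trivial at infinity because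
  -- dividing by the absolute value cancels the factor `z * conj z` of `φ₁ / φ₂.conj`
  let θ : HeckeCharacter F := φ₁ / (φ₂.conj * (φ₁ / φ₂).abs)
  have hθ (x : Ideles F) : ((θ.1 x : ℂˣ) : ℂ) =
      φ₁.1 x / (φ₂.1 (conjIdele F x) * ‖((φ₁.1 x : ℂˣ) : ℂ) / φ₂.1 x‖) := by
    simp only [θ, HeckeCharacter.div_apply, HeckeCharacter.mul_apply, HeckeCharacter.abs_apply,
      HeckeCharacter.conj_apply, Units.val_div_eq_div_val, Units.val_mul]
  have hχ' (x : Ideles F) : ((φ₁.1 (conjIdele F x) : ℂˣ) : ℂ) / φ₂.1 (conjIdele F x) =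
      starRingEnd ℂ (((φ₁.1 x : ℂˣ) : ℂ) / φ₂.1 x) := by
    have h := congrArg (fun ψ : HeckeCharacter F ↦ ((ψ.1 x : ℂˣ) : ℂ)) hχ
    simp only [HeckeCharacter.conj_apply, HeckeCharacter.div_apply, Units.val_div_eq_div_val] at h
    rw [h]
    change starRingEnd ℂ (((φ₁ / φ₂).1 x : ℂˣ) : ℂ) = _
    rw [HeckeCharacter.div_apply, Units.val_div_eq_div_val]
  have habs (x : Ideles F) : ((φ₁.1 x : ℂˣ) : ℂ) / φ₂.1 x *
      (((φ₁.1 (conjIdele F x) : ℂˣ) : ℂ) / φ₂.1 (conjIdele F x)) =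
      (‖((φ₁.1 x : ℂˣ) : ℂ) / φ₂.1 x‖ : ℂ) ^ 2 := by
    rw [hχ', Complex.mul_conj']
  have hn0 (x : Ideles F) : (‖((φ₁.1 x : ℂˣ) : ℂ) / φ₂.1 x‖ : ℂ) ≠ 0 := by
    rw [Ne, Complex.ofReal_eq_zero, norm_eq_zero]
    exact div_ne_zero (Units.ne_zero _) (Units.ne_zero _)
  have hnc (x : Ideles F) : ‖((φ₁.1 (conjIdele F x) : ℂˣ) : ℂ) / φ₂.1 (conjIdele F x)‖ =
      ‖((φ₁.1 x : ℂˣ) : ℂ) / φ₂.1 x‖ := by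
    rw [hχ', RCLike.norm_conj]
  have hinf (x : Ideles F) (hx : x.val.2 = 1) : θ.1 x = 1 := by
    apply Units.ext
    have h2 := hφ₂ (conjIdele F x) (conjIdele_snd_eq_one hx)
    rw [embeddingExtension_conjIdele] at h2
    have h1 := hφ₁ x hx
    have h3 := hφ₂ x hx
    set z := embeddingExtension ι (x.val.1 (InfinitePlace.mk ι))
    rw [zpow_one, zpow_zero, mul_one] at h1
    rw [zpow_neg_one, zpow_zero, mul_one] at h2 h3
    have hz : z ≠ 0 := h1 ▸ Units.ne_zero _
    have hz' : starRingEnd ℂ z ≠ 0 := (map_ne_zero _).2 hz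
    have h4 : (‖z / z⁻¹‖ : ℂ) = z * starRingEnd ℂ z := by
      rw [Complex.mul_conj', div_inv_eq_mul, norm_mul, Complex.ofReal_mul, sq]
    rw [hθ, h1, h2, h3, h4, Units.val_one]
    field_simp
  have hc (x : Ideles F) : θ.1 (conjIdele F x) = (θ.1 x)⁻¹ := by
    rw [eq_inv_iff_mul_eq_one]
    apply Units.ext
    rw [Units.val_mul, hθ, hθ, conjIdele_conjIdele, hnc, Units.val_one]
    have h := habs x
    have h0 := hn0 x
    have h1 := Units.ne_zero (φ₂.1 x)
    have h2 := Units.ne_zero (φ₂.1 (conjIdele F x))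
    set n := (‖((φ₁.1 x : ℂˣ) : ℂ) / φ₂.1 x‖ : ℂ)
    field_simp at h ⊢
    linear_combination h
  have hur (v) (hv : v ∉ badPlaces p φ₁ φ₂) : θ.IsUnramifiedAt v := by
    have h1 : φ₁.IsUnramifiedAt v := HeckeCharacter.isUnramifiedAt_of_not_dvd_conductor
      fun h ↦ hv (.inl h)
    have h2 : φ₂.IsUnramifiedAt v := HeckeCharacter.isUnramifiedAt_of_not_dvd_conductor
      fun h ↦ hv (.inr (.inl h))
    have h3 : φ₂.conj.IsUnramifiedAt v := HeckeCharacter.IsUnramifiedAt.conj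
      (HeckeCharacter.isUnramifiedAt_of_not_dvd_conductor fun h ↦
        hv (.inr (.inr (.inr (.inl ((dvd_map_conjugation_iff v _).2 h))))))
    intro x hx hx1 hxv
    apply Units.ext
    have h4 := h3 x hx hx1 hxv
    rw [HeckeCharacter.conj_apply] at h4
    rw [hθ, h1 x hx hx1 hxv, h2 x hx hx1 hxv, h4]
    simp
  obtain ⟨η, hη, hηur, hηθ⟩ := exists_conj_div_eq (fun v ↦ pullPlace_mem_badPlaces)
    (fun v ↦ discr_notMem_of_notMem_badPlaces) θ hinf hc hur
  refine ⟨η, hη, hηur, HeckeCharacter.ext_apply fun x ↦ Units.ext ?_⟩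
  have h1 : ((η.1 (conjIdele F x) : ℂˣ) : ℂ) = θ.1 x * η.1 x := by
    rw [← hηθ, HeckeCharacter.div_apply, HeckeCharacter.conj_apply, ← Units.val_mul,
      div_mul_cancel]
  rw [HeckeCharacter.conj_apply]
  simp only [HeckeCharacter.mul_apply, HeckeCharacter.pow_apply, Units.val_mul,
    Units.val_pow_eq_pow_val]
  rw [h1, hθ]
  have h := habs x
  have h0 := hn0 x
  have h2 := Units.ne_zero (φ₂.1 x)
  have h3 := Units.ne_zero (φ₂.1 (conjIdele F x))
  set n := (‖((φ₁.1 x : ℂˣ) : ℂ) / φ₂.1 x‖ : ℂ)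
  field_simp at h ⊢
  linear_combination h
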